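/- For a partition $\mu=(\mu_1\ge\mu_2\ge\dots)$ let $\mu'_i=\#\{j:\mu_j\ge i\}$ and $m_i(\mu)=\#\{j:\mu_j=i\}$, and let $(t;t)_m=\prod_{k=1}^m(1-t^k)$. For real $t\in(-1,1)$ and $n\ge \mu_1'$, the Hall–Littlewood polynomial is $$P_\mu(x_1,\dots,x_n;t)=\frac{1}{V_\mu(t)}\sum_{\sigma\in S_n}\sigma\Big(x_1^{\mu_1}\cdots x_n^{\mu_n}\prod_{1\le i<j\le n}\frac{x_i-tx_j}{x_i-x_j}\Big),\qquad V_\mu(t)=\prod_{i\ge 0}\frac{(t;t)_{m_i}}{(1-t)^{m_i}},$$ where $m_i$ is the number of entries equal to $i$ in $(\mu_1,\dots,\mu_n)$ (in $V_\mu$ the index $i=0$ is included), and $P_\mu(x_1,\dots,x_n;t)=0$ if $n<\mu'_1$. Set $Q_\mu(x_1,\dots,x_n;t)=\prod_{i\ge1}(t;t)_{m_i(\mu)}\,P_\mu(x_1,\dots,x_n;t)$. For infinite sequences of real numbers put $P_\mu(a_1,a_2,\dots;t)=\lim_{n\to\infty}P_\mu(a_1,\dots,a_n;t)$ when the limit exists,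 similarly for $Q_\mu$, and $P_\mu(a_1,a_2,\dots,b_1,b_2,\dots;t)=\lim_{m,n\to\infty}P_\mu(a_1,\dots,a_m,b_1,\dots,b_n;t)$. **Proposition 1.3.** Let $t\in(-1,1)\setminus\{0\}$, and let $a_1,a_2,\dots$ be real numbers such that the limits $P_\mu(a_1,a_2,\dots;t)$ exist for all partitions $\mu$, the sum $$\sum_{\mu}P_\mu(a_1,a_2,\dots;t)\,Q_\mu(1,t,t^2,\dots;t)$$ over all partitions $\mu$ converges, and its summands are all nonnegative. Let $\lambda$ be a random partition such that $\mathbf P(\lambda=\mu)$ is proportional to the $\mu$ summand of this sum, for each partition $\mu$. Then for every fixed partition $\nu$, $$\mathbb E\big[t^{-\sum_{i}\lambda'_i\nu'_i}\big]=\frac{P_\nu(a_1,a_2,\dots,t,t^2,\dots;t)}{P_\nu(t,t^2,\dots;t)}.$$ Here all quantities are well defined: the limits $Q_\mu(1,t,t^2,\dots;t)$ (for every $\mu$), $P_\nu(a_1,a_2,\dots,t,t^2,\dots;t)$ and $P_\nu(t,t^2,\dots;t)$ exist, the last one is nonzero, the total sum of the weights is positive, and the random variable in the expectation is integrable. -/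

import Mathlib

open MeasureTheory Filter Topology

noncomputable section

namespace HallLittlewood

/-! Partitions are Mathlib's Young diagrams: with indices starting at `0`, `μ.rowLen i` is the part
`μ_{i+1}`, and `μ.colLen i` is the part `μ'_{i+1}` of the conjugate partition. -/

/-- The `q`-Pochhammer symbol `(a; q)_n = (1 - a) (1 - a q) ⋯ (1 - a q^(n-1))`. -/
def qPochhammer (a q : ℝ) (n : ℕ) : ℝ := ∏ k ∈ Finset.range n, (1 - a * q ^ k)

/-- The multiplicity `m_i(μ)` of `i` among the first `n` entries `μ_1, …, μ_n` of `μ`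
(for `i = 0` the trailing zeros up to position `n` are counted). -/
def multAmong (n : ℕ) (μ : YoungDiagram) (i : ℕ) : ℕ :=
  (Finset.univ.filter fun j : Fin n => μ.rowLen j = i).card

/-- The multiplicity `m_i(μ)` of `i ≥ 1` as a part of the partition `μ`. -/
def mult (μ : YoungDiagram) (i : ℕ) : ℕ := μ.rowLens.count i

/-- The normalization `V_μ(t) = ∏_{i ≥ 0} (t; t)_{m_i} / (1 - t)^{m_i}`, where `m_i` is the number
of entries of `(μ_1, …, μ_n)` which are equal to `i`. -/
def V (t : ℝ) (n : ℕ) (μ : YoungDiagram) : ℝ :=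
  ∏ i ∈ Finset.range (μ.rowLen 0 + 1),
    qPochhammer t t (multAmong n μ i) / (1 - t) ^ multAmong n μ i

/-- The variable `x_i` in the field `ℝ(x_1, …, x_n)` of rational functions. -/
def ratX {n : ℕ} (i : Fin n) : FractionRing (MvPolynomial (Fin n) ℝ) :=
  algebraMap (MvPolynomial (Fin n) ℝ) _ (MvPolynomial.X i)

/-- The constant `c` in the field `ℝ(x_1, …, x_n)` of rational functions. -/
def ratC (n : ℕ) (c : ℝ) : FractionRing (MvPolynomial (Fin n) ℝ) :=
  algebraMap (MvPolynomial (Fin n) ℝ) _ (MvPolynomial.C c)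

/-- The rational function
`V_μ(t)⁻¹ ∑_{σ ∈ S_n} σ(x_1^{μ_1} ⋯ x_n^{μ_n} ∏_{i < j} (x_i - t x_j) / (x_i - x_j))`. -/
def ratP (t : ℝ) (n : ℕ) (μ : YoungDiagram) : FractionRing (MvPolynomial (Fin n) ℝ) :=
  (ratC n (V t n μ))⁻¹ * ∑ σ : Equiv.Perm (Fin n),
    (∏ i : Fin n, ratX (σ i) ^ μ.rowLen i) *
      ∏ i : Fin n, ∏ j ∈ Finset.Ioi i,
        (ratX (σ i) - ratC n t * ratX (σ j)) / (ratX (σ i) - ratX (σ j))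

/-! The rational function `ratP` is a polynomial. -/

/-- Substitution of `x_j` for `x_i`. -/
def substVar {n : ℕ} (i j : Fin n) : MvPolynomial (Fin n) ℝ →ₐ[ℝ] MvPolynomial (Fin n) ℝ :=
  MvPolynomial.aeval fun k => if k = i then MvPolynomial.X j else MvPolynomial.X k

lemma X_sub_X_dvd_iff {n : ℕ} (i j : Fin n) (f : MvPolynomial (Fin n) ℝ) :
    (MvPolynomial.X i - MvPolynomial.X j) ∣ f ↔ substVar i j f = 0 := by
  constructor
  · rintro ⟨g, rfl⟩
    rw [map_mul, map_sub]
    simp [substVar]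
  · intro h
    suffices H : (MvPolynomial.X i - MvPolynomial.X j) ∣ f - substVar i j f by simpa [h] using H
    clear h
    induction f using MvPolynomial.induction_on with
    | C a => simp [substVar]
    | add p q hp hq =>
      rw [map_add, add_sub_add_comm]
      exact dvd_add hp hq
    | mul_X p k hp =>
      have hX : (MvPolynomial.X i - MvPolynomial.X j : MvPolynomial (Fin n) ℝ) ∣
          MvPolynomial.X k - substVar i j (MvPolynomial.X k) := by
        by_cases hk : k = i
        · subst hk
          simp [substVar]
        · simp [substVar, hk]
      rw [map_mul]
      have : p * MvPolynomial.X k - substVar i j p * substVar i j (MvPolynomial.X k) =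
          (p - substVar i j p) * MvPolynomial.X k +
            substVar i j p * (MvPolynomial.X k - substVar i j (MvPolynomial.X k)) := by ring
      rw [this]
      exact dvd_add (Dvd.dvd.mul_right hp _) (Dvd.dvd.mul_left hX _)

lemma X_sub_X_ne_zero {n : ℕ} {i j : Fin n} (hij : i ≠ j) :
    (MvPolynomial.X i - MvPolynomial.X j : MvPolynomial (Fin n) ℝ) ≠ 0 := by
  rw [sub_ne_zero]
  exact fun h => hij (MvPolynomial.X_injective h)

lemma X_sub_X_prime {n : ℕ} {i j : Fin n} (hij : i ≠ j) :
    Prime (MvPolynomial.X i - MvPolynomial.X j : MvPolynomial (Fin n) ℝ) := by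
  refine ⟨X_sub_X_ne_zero hij, fun hu => ?_, fun a b h => ?_⟩
  · have h1 := (X_sub_X_dvd_iff i j (1 : MvPolynomial (Fin n) ℝ)).1 hu.dvd
    simp at h1
  · simpa only [X_sub_X_dvd_iff, map_mul, mul_eq_zero] using h

/-- The antisymmetric numerator of `ratP`. -/
def antisymNum (t : ℝ) (n : ℕ) (μ : YoungDiagram) : MvPolynomial (Fin n) ℝ :=
  ∑ σ : Equiv.Perm (Fin n), ((Equiv.Perm.sign σ : ℤ) : MvPolynomial (Fin n) ℝ) *
    ((∏ i : Fin n, MvPolynomial.X (σ i) ^ μ.rowLen i) *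
      ∏ i : Fin n, ∏ j ∈ Finset.Ioi i,
        (MvPolynomial.X (σ i) - MvPolynomial.C t * MvPolynomial.X (σ j)))

lemma rename_antisymNum (t : ℝ) (n : ℕ) (μ : YoungDiagram) (τ : Equiv.Perm (Fin n)) :
    MvPolynomial.rename τ (antisymNum t n μ) =
      ((Equiv.Perm.sign τ : ℤ) : MvPolynomial (Fin n) ℝ) * antisymNum t n μ := by
  have hs : ((Equiv.Perm.sign τ : ℤ) : MvPolynomial (Fin n) ℝ) *
      ((Equiv.Perm.sign τ : ℤ) : MvPolynomial (Fin n) ℝ) = 1 := by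
    rw [← Int.cast_mul, ← Units.val_mul, Int.units_mul_self]
    simp
  unfold antisymNum
  rw [Finset.mul_sum, map_sum]
  refine Fintype.sum_equiv (Equiv.mulLeft τ) _ _ fun σ => ?_
  simp only [Equiv.coe_mulLeft, Units.val_mul, Int.cast_mul,
    Equiv.Perm.coe_mul, Function.comp_apply, map_mul, map_intCast, map_prod, map_pow, map_sub,
    MvPolynomial.rename_X, MvPolynomial.rename_C]
  simp only [← mul_assoc]
  rw [hs, one_mul]

lemma X_sub_X_dvd_antisymNum (t : ℝ) (n : ℕ) (μ : YoungDiagram) {i j : Fin n} (hij : i ≠ j) :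
    (MvPolynomial.X i - MvPolynomial.X j) ∣ antisymNum t n μ := by
  rw [X_sub_X_dvd_iff]
  have h1 := congrArg (substVar i j) (rename_antisymNum t n μ (Equiv.swap i j))
  have h2 : substVar i j (MvPolynomial.rename (Equiv.swap i j) (antisymNum t n μ)) =
      substVar i j (antisymNum t n μ) := by
    unfold substVar
    rw [MvPolynomial.aeval_rename]
    congr 2
    funext k
    simp only [Function.comp_apply]
    by_cases hki : k = i
    · subst hki
      simp [Ne.symm hij]
    · by_cases hkj : k = j
      · subst hkj
        simp [hki]
      · simp [Equiv.swap_apply_of_ne_of_ne hki hkj, hki]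
  rw [h2, Equiv.Perm.sign_swap hij, map_mul, map_intCast] at h1
  simp only [Units.val_neg, Units.val_one, Int.cast_neg, Int.cast_one, neg_mul, one_mul] at h1
  exact self_eq_neg.1 h1

lemma vandermonde_dvd_antisymNum (t : ℝ) (n : ℕ) (μ : YoungDiagram) :
    (∏ i : Fin n, ∏ j ∈ Finset.Ioi i, (MvPolynomial.X i - MvPolynomial.X j)) ∣
      antisymNum t n μ := by
  rw [Finset.prod_sigma']
  refine Finset.prod_dvd_of_isRelPrime ?_ fun p hp => ?_
  · rintro ⟨i, j⟩ hp ⟨k, l⟩ hq hne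
    have hij : i < j := by simpa using hp
    have hkl : k < l := by simpa using hq
    rw [Function.onFun, (X_sub_X_prime hij.ne).irreducible.isRelPrime_iff_not_dvd,
      X_sub_X_dvd_iff]
    simp only [map_sub, substVar, MvPolynomial.aeval_X]
    rw [sub_eq_zero]
    by_cases h1 : k = i
    · have hl : l ≠ i := by
        rintro rfl
        exact hkl.ne h1
      rw [if_pos h1, if_neg hl]
      intro h
      have := MvPolynomial.X_injective h
      subst h1 this
      exact hne rfl
    · by_cases h2 : l = i
      · rw [if_neg h1, if_pos h2]
        intro h
        have := MvPolynomial.X_injective h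
        omega
      · rw [if_neg h1, if_neg h2]
        intro h
        exact hkl.ne (MvPolynomial.X_injective h)
  · have hij : p.1 < p.2 := by simpa using hp
    exact X_sub_X_dvd_antisymNum t n μ hij.ne

/-- The rational function `ratP` is a polynomial in `x_1, …, x_n`. -/
lemma exists_polynomial (t : ℝ) (n : ℕ) (μ : YoungDiagram) :
    ∃ p : MvPolynomial (Fin n) ℝ, algebraMap (MvPolynomial (Fin n) ℝ) _ p = ratP t n μ := by
  obtain ⟨g, hg⟩ := vandermonde_dvd_antisymNum t n μ
  set φ := algebraMap (MvPolynomial (Fin n) ℝ) (FractionRing (MvPolynomial (Fin n) ℝ)) with hφ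
  set D : FractionRing (MvPolynomial (Fin n) ℝ) :=
    ∏ i : Fin n, ∏ j ∈ Finset.Ioi i, (ratX i - ratX j) with hD
  have hD0 : D ≠ 0 := by
    refine Finset.prod_ne_zero_iff.2 fun i _ => Finset.prod_ne_zero_iff.2 fun j hj => ?_
    have hij : i ≠ j := (Finset.mem_Ioi.1 hj).ne
    unfold ratX
    rw [← map_sub]
    exact (map_ne_zero_iff _ (IsFractionRing.injective _ _)).2 (X_sub_X_ne_zero hij)
  refine ⟨MvPolynomial.C (V t n μ)⁻¹ * g, ?_⟩
  have hC : φ (MvPolynomial.C (V t n μ)⁻¹) = (ratC n (V t n μ))⁻¹ :=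
    map_inv₀ (φ.comp MvPolynomial.C) _
  rw [map_mul, hC]
  unfold ratP
  congr 1
  have h1 : φ (antisymNum t n μ) = D * φ g := by
    rw [hg, map_mul, map_prod]
    simp only [map_prod, map_sub]
    rfl
  refine mul_left_cancel₀ hD0 ?_
  rw [← h1, Finset.mul_sum, antisymNum, map_sum]
  refine Finset.sum_congr rfl fun σ _ => ?_
  have hσ := σ.prod_Ioi_comp_eq_sign_mul_prod
    (f := fun i j => (ratX i - ratX j : FractionRing (MvPolynomial (Fin n) ℝ)))
    (fun i j => by ring)
  have hs : (((Equiv.Perm.sign σ : ℤ) : FractionRing (MvPolynomial (Fin n) ℝ))) *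
      ((Equiv.Perm.sign σ : ℤ) : FractionRing (MvPolynomial (Fin n) ℝ)) = 1 := by
    rw [← Int.cast_mul, ← Units.val_mul, Int.units_mul_self]
    simp
  have hs0 : ((Equiv.Perm.sign σ : ℤ) : FractionRing (MvPolynomial (Fin n) ℝ)) ≠ 0 :=
    left_ne_zero_of_mul_eq_one hs
  simp only [Finset.prod_div_distrib]
  rw [hσ, ← hD]
  simp only [map_mul, map_intCast, map_prod, map_pow, map_sub]
  have e1 : ∀ i : Fin n, φ (MvPolynomial.X i) = ratX i := fun _ => rfl
  have e2 : φ (MvPolynomial.C t) = ratC n t := rfl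
  simp only [e1, e2]
  field_simp
  rw [pow_two, hs, one_mul]

/-- The Hall-Littlewood polynomial `P_μ(x_1, …, x_n; t)`: for `l(μ) ≤ n` it is the polynomial
`V_μ(t)⁻¹ ∑_{σ ∈ S_n} σ(x^μ ∏_{i < j} (x_i - t x_j) / (x_i - x_j))`, and for `l(μ) > n` it is `0`. -/
def polyP (t : ℝ) (n : ℕ) (μ : YoungDiagram) : MvPolynomial (Fin n) ℝ :=
  if μ.colLen 0 ≤ n then Classical.choose (exists_polynomial t n μ) else 0

/-- The value `P_μ(x_1, …, x_n; t)` at real numbers `x_1, …, x_n`. -/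
def P (t : ℝ) (μ : YoungDiagram) {n : ℕ} (x : Fin n → ℝ) : ℝ :=
  MvPolynomial.eval x (polyP t n μ)

/-- The value `Q_μ(x_1, …, x_n; t) = ∏_{i ≥ 1} (t; t)_{m_i(μ)} P_μ(x_1, …, x_n; t)` of the dual
Hall-Littlewood polynomial. -/
def Q (t : ℝ) (μ : YoungDiagram) {n : ℕ} (x : Fin n → ℝ) : ℝ :=
  (∏ i ∈ Finset.Icc 1 (μ.rowLen 0), qPochhammer t t (mult μ i)) * P t μ x

/-- The limit `P_μ(a_1, a_2, …; t) = lim_n P_μ(a_1, …, a_n; t)` exists. -/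
def PConverges (t : ℝ) (μ : YoungDiagram) (a : ℕ → ℝ) : Prop :=
  ∃ L : ℝ, Tendsto (fun n : ℕ => P t μ fun i : Fin n => a i) atTop (𝓝 L)

/-- The limit `Q_μ(b_1, b_2, …; t) = lim_n Q_μ(b_1, …, b_n; t)` exists. -/
def QConverges (t : ℝ) (μ : YoungDiagram) (b : ℕ → ℝ) : Prop :=
  ∃ L : ℝ, Tendsto (fun n : ℕ => Q t μ fun i : Fin n => b i) atTop (𝓝 L)

/-- `P_μ(a_1, a_2, …; t) = lim_n P_μ(a_1, …, a_n; t)`. -/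
def PInf (t : ℝ) (μ : YoungDiagram) (a : ℕ → ℝ) : ℝ :=
  limUnder atTop fun n : ℕ => P t μ fun i : Fin n => a i

/-- `Q_μ(b_1, b_2, …; t) = lim_n Q_μ(b_1, …, b_n; t)`. -/
def QInf (t : ℝ) (μ : YoungDiagram) (b : ℕ → ℝ) : ℝ :=
  limUnder atTop fun n : ℕ => Q t μ fun i : Fin n => b i

/-- The limit of `P_μ(a_1, …, a_m, b_1, …, b_n; t)` as `m, n → ∞` (independently) exists. -/
def PAppendConverges (t : ℝ) (μ : YoungDiagram) (a b : ℕ → ℝ) : Prop :=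
  ∃ L : ℝ, Tendsto (fun mn : ℕ × ℕ =>
    P t μ (Fin.append (fun i : Fin mn.1 => a i) (fun j : Fin mn.2 => b j)))
    (atTop ×ˢ atTop) (𝓝 L)

/-- `P_μ(a_1, a_2, …, b_1, b_2, …; t)`, the limit of `P_μ(a_1, …, a_m, b_1, …, b_n; t)` as
`m, n → ∞` (independently). -/
def PAppendInf (t : ℝ) (μ : YoungDiagram) (a b : ℕ → ℝ) : ℝ :=
  limUnder (atTop ×ˢ atTop) fun mn : ℕ × ℕ =>
    P t μ (Fin.append (fun i : Fin mn.1 => a i) (fun j : Fin mn.2 => b j))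

/-- The weight `P_μ(a_1, a_2, …; t) Q_μ(1, t, t², …; t)` of the partition `μ`. -/
def weight (t : ℝ) (a : ℕ → ℝ) (μ : YoungDiagram) : ℝ :=
  PInf t μ a * QInf t μ fun i => t ^ i

/-- The number `∑_{i ≥ 1} μ'_i ν'_i` (the terms with `i > ν_1` vanish). -/
def conjPairing (μ ν : YoungDiagram) : ℕ :=
  ∑ i ∈ Finset.range (ν.rowLen 0), μ.colLen i * ν.colLen i

end HallLittlewood

end

noncomputable section

namespace HallLittlewood

open Finset

/-! ### Rational function identities -/

/-! Write n(μ) for the sum of the binomials C(μ'_j, 2). Since Q_μ(1, t, t², …; t) = t^n(μ), the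
moment is, up to normalization, the sum over λ of P_λ(a) t^(n(λ) - ∑ λ'_i ν'_i). The heart of the
proof is the power series identity `prod_mul_momentSeries` for finitely many variables, ∏ (1 - x_i
X) · ∑_λ P_λ(x) t^(n(λ) - ∑ λ'_i ν'_i) X^|λ| = P_ν(x_1 X, …, x_n X, t, t², …) / P_ν(t, t², …),
proved by induction on the number of variables.

To separate one variable z, the branching rule is applied on both sides. On the right it removes
horizontal strips from ν; on the left it adds horizontal strips to a smaller partition μ. For fixed
μ, both become generating functions of sets T of columns, with weights that only see whether
neighbouring columns lie in T. By `colStep_rel` both generating functions obey the same three-term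
recurrence, so that they agree to high order up to the factor 1 - X (`X_pow_dvd_colsGen`). This
accounts for the factor 1 - zX.

The branching rule and the principal specialization both come from a column by column formula,
`colP`: the first column, of length c, selects a set A of c variables, contributes their product and
the cross factors (x - ty)/(x - y) with x in A and y outside, and the remaining columns are
evaluated on A. At distinct points this agrees with the symmetrization (`symSum_eq`) and satisfies
the branching rule (`colP_insert`); polynomial identities then extend to all points.

For infinitely many variables the product over x_i is eliminated by the case ν = ∅, and each
coefficient in X involves only finitely many P_μ, so limits may be taken coefficientwise. Setting X
= 1 is a Cauchy product of the summable weights with a polynomial. For t < 0 the moment summands may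
change sign; they are dominated by the nonnegative ones for ν with all columns doubled. -/

/-- The factor `∏_{x ∈ A, y ∈ B} (x - t y) / (x - y)`. -/
def crossProd (t : ℝ) (A B : Finset ℝ) : ℝ := ∏ x ∈ A, ∏ y ∈ B, (x - t * y) / (x - y)

/-- The `t`-integer `1 + t + ⋯ + t^(n-1)`. -/
def tInt (t : ℝ) (n : ℕ) : ℝ := ∑ i ∈ range n, t ^ i

lemma tInt_succ (t : ℝ) (n : ℕ) : tInt t (n + 1) = tInt t n + t ^ n := by
  rw [tInt, tInt, sum_range_succ]

lemma tInt_succ' (t : ℝ) (n : ℕ) : tInt t (n + 1) = 1 + t * tInt t n := by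
  rw [tInt, tInt, sum_range_succ', mul_sum, add_comm]
  simp [pow_succ']

lemma tInt_mul (t : ℝ) (n : ℕ) : tInt t n * (1 - t) = 1 - t ^ n :=
  geom_sum_mul_neg t n

lemma crossProd_singleton_left (t z : ℝ) (B : Finset ℝ) :
    crossProd t {z} B = ∏ y ∈ B, (z - t * y) / (z - y) := by simp [crossProd]

lemma crossProd_singleton_right (t z : ℝ) (A : Finset ℝ) :
    crossProd t A {z} = ∏ x ∈ A, (x - t * z) / (x - z) := by simp [crossProd]

lemma crossProd_insert_left (t : ℝ) {z : ℝ} {A : Finset ℝ} (hz : z ∉ A) (B : Finset ℝ) :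
    crossProd t (insert z A) B = crossProd t {z} B * crossProd t A B := by
  simp [crossProd, prod_insert hz]

lemma crossProd_insert_right (t : ℝ) {z : ℝ} {B : Finset ℝ} (hz : z ∉ B) (A : Finset ℝ) :
    crossProd t A (insert z B) = crossProd t A {z} * crossProd t A B := by
  simp [crossProd, prod_insert hz, prod_mul_distrib]

lemma crossProd_empty_left (t : ℝ) (B : Finset ℝ) : crossProd t ∅ B = 1 := by simp [crossProd]

lemma crossProd_empty_right (t : ℝ) (A : Finset ℝ) : crossProd t A ∅ = 1 := by simp [crossProd]

lemma crossProd_union_left (t : ℝ) {A A' : Finset ℝ} (h : Disjoint A A') (B : Finset ℝ) :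
    crossProd t (A ∪ A') B = crossProd t A B * crossProd t A' B := by
  simp [crossProd, prod_union h]

/-- Partial fraction expansion of `∏_j (z - t j) / (z - j)` in `z`. -/
lemma crossProd_singleton_left_eq (t : ℝ) (B : Finset ℝ) : ∀ z ∉ B,
    crossProd t {z} B =
      1 + ∑ j ∈ B, (1 - t) * j / (z - j) * crossProd t {j} (B.erase j) := by
  induction B using Finset.induction_on with
  | empty => simp [crossProd]
  | insert b B hb ih =>
    intro z hz
    rw [mem_insert, not_or] at hz
    have hzb : z - b ≠ 0 := sub_ne_zero.2 hz.1
    rw [crossProd_insert_right t hb, ih z hz.2, sum_insert hb, erase_insert hb, ih b hb,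
      crossProd_singleton_left, prod_singleton, mul_add, mul_sum, mul_add, mul_sum, mul_one, mul_one,
      add_assoc, ← add_assoc (1 : ℝ), ← sum_add_distrib]
    congr 1
    · field_simp; ring
    · refine sum_congr rfl fun j hj => ?_
      have hjb : j ≠ b := fun h => hb (h ▸ hj)
      have hjz : z - j ≠ 0 := sub_ne_zero.2 fun h => hz.2 (h ▸ hj)
      have h1 : j - b ≠ 0 := sub_ne_zero.2 hjb
      have h2 : b - j ≠ 0 := sub_ne_zero.2 hjb.symm
      rw [erase_insert_of_ne hjb.symm, crossProd_insert_right t (by simp [hb]),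
        crossProd_singleton_left t j {b}, prod_singleton]
      generalize crossProd t {j} (B.erase j) = W
      have h3 : b - j = -(j - b) := by ring
      rw [h3]
      field_simp
      ring

/-- Partial fraction expansion of `∏_i (i - t z) / (i - z)` in `z`. -/
lemma crossProd_singleton_right_eq (t : ℝ) (B : Finset ℝ) : ∀ z ∉ B,
    crossProd t B {z} =
      1 + ∑ j ∈ B, (1 - t) * z / (j - z) * crossProd t (B.erase j) {j} := by
  induction B using Finset.induction_on with
  | empty => simp [crossProd]
  | insert b B hb ih =>
    intro z hz
    rw [mem_insert, not_or] at hz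
    have hzb : b - z ≠ 0 := sub_ne_zero.2 (Ne.symm hz.1)
    rw [crossProd_insert_left t hb, ih z hz.2, sum_insert hb, erase_insert hb, ih b hb,
      crossProd_singleton_left, prod_singleton, mul_add, mul_sum, mul_add, mul_sum, mul_one, mul_one,
      add_assoc, ← add_assoc (1 : ℝ), ← sum_add_distrib]
    congr 1
    · field_simp; ring
    · refine sum_congr rfl fun j hj => ?_
      have hjb : j ≠ b := fun h => hb (h ▸ hj)
      have hjz : j - z ≠ 0 := sub_ne_zero.2 fun h => hz.2 (h ▸ hj)
      have h1 : j - b ≠ 0 := sub_ne_zero.2 hjb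
      rw [erase_insert_of_ne hjb.symm, crossProd_insert_left t (by simp [hb]),
        crossProd_singleton_left t b {j}, prod_singleton]
      generalize crossProd t (B.erase j) {j} = W
      have h3 : b - j = -(j - b) := by ring
      rw [h3]
      field_simp
      ring

/-- A new point z multiplies the j-th summand by (z - tj)/(z - j), while the partial fractions of
the new summand contribute (1 - t)z/(j - z) times the old one. The two factors add up to t, which is
the recursion [n+1] = 1 + t[n]. -/
lemma sum_crossProd_erase (t : ℝ) (B : Finset ℝ) :
    ∑ j ∈ B, crossProd t (B.erase j) {j} = tInt t B.card := by
  induction B using Finset.induction_on with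
  | empty => simp [tInt]
  | insert z B hz ih =>
    rw [sum_insert hz, erase_insert hz, card_insert_of_notMem hz, tInt_succ', ← ih,
      crossProd_singleton_right_eq t B z hz, mul_sum, add_assoc, ← sum_add_distrib]
    congr 1
    refine sum_congr rfl fun j hj => ?_
    have hjz : z ≠ j := fun h => hz (h ▸ hj)
    have h1 : j - z ≠ 0 := sub_ne_zero.2 hjz.symm
    rw [erase_insert_of_ne hjz, crossProd_insert_left t (by simp [hz]),
      crossProd_singleton_left t z {j}, prod_singleton]
    generalize crossProd t (B.erase j) {j} = W
    have h3 : z - j = -(j - z) := by ring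
    rw [h3]
    field_simp
    ring

/-! ### Hall-Littlewood polynomials at distinct points, column by column -/

/-- The Hall-Littlewood polynomial indexed by the partition with columns `c 0, …, c (N - 1)`,
evaluated at a set of distinct points; columns are removed recursively. It vanishes if `c` is not
antitone or if the first column exceeds the number of points. -/
def colP (t : ℝ) : ℕ → (ℕ → ℕ) → Finset ℝ → ℝ
  | 0, _, _ => 1
  | N + 1, c, I => ∑ A ∈ I.powersetCard (c 0),
      (∏ x ∈ A, x) * colP t N (fun j => c (j + 1)) A * crossProd t A (I \ A)

lemma colP_zero (t : ℝ) (c : ℕ → ℕ) (I : Finset ℝ) : colP t 0 c I = 1 := rfl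

lemma colP_succ (t : ℝ) (N : ℕ) (c : ℕ → ℕ) (I : Finset ℝ) :
    colP t (N + 1) c I = ∑ A ∈ I.powersetCard (c 0),
      (∏ x ∈ A, x) * colP t N (fun j => c (j + 1)) A * crossProd t A (I \ A) := rfl

lemma colP_eq_one (t : ℝ) (N : ℕ) (c : ℕ → ℕ) (hc : ∀ j, c j = 0) (I : Finset ℝ) :
    colP t N c I = 1 := by
  induction N generalizing c I with
  | zero => rfl
  | succ N ih =>
    rw [colP_succ, hc 0, powersetCard_zero, sum_singleton, ih _ fun j => hc _]
    simp [crossProd_empty_left]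

lemma colP_eq_zero_of_card_lt (t : ℝ) (N : ℕ) (c : ℕ → ℕ) (hN : ∀ j, N ≤ j → c j = 0)
    (I : Finset ℝ) (h : I.card < c 0) : colP t N c I = 0 := by
  cases N with
  | zero => simp [hN 0 le_rfl] at h
  | succ N => rw [colP_succ, powersetCard_eq_empty.2 h, sum_empty]

/-- A column longer than its predecessor would have to select its variables from too small a set.
Thus branching sums may run over all sets of columns, without selecting the horizontal strips. -/
lemma colP_eq_zero_of_not_antitone (t : ℝ) (N : ℕ) (c : ℕ → ℕ) (hN : ∀ j, N ≤ j → c j = 0)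
    (I : Finset ℝ) (h : ¬ Antitone c) : colP t N c I = 0 := by
  induction N generalizing c I with
  | zero => exact absurd (fun i j _ => by rw [hN i (Nat.zero_le _), hN j (Nat.zero_le _)]) h
  | succ N ih =>
    rw [colP_succ]
    refine sum_eq_zero fun A hA => ?_
    suffices colP t N (fun j => c (j + 1)) A = 0 by rw [this, mul_zero, zero_mul]
    have hN' : ∀ j, N ≤ j → c (j + 1) = 0 := fun j hj => hN _ (by omega)
    by_cases h1 : c 0 < c 1
    · exact colP_eq_zero_of_card_lt t N _ hN' A (by rw [(mem_powersetCard.1 hA).2]; exact h1)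
    · refine ih _ hN' A fun h2 => h ?_
      refine antitone_nat_of_succ_le fun n => ?_
      cases n with
      | zero => exact not_lt.1 h1
      | succ n => exact h2 (Nat.le_succ n)

/-- Removing one zero entry. -/
lemma sum_colP_erase (t : ℝ) (N : ℕ) (c : ℕ → ℕ) (hN : ∀ j, N ≤ j → c j = 0) (I : Finset ℝ) :
    ∑ j ∈ I, colP t N c (I.erase j) * crossProd t (I.erase j) {j} =
      tInt t (I.card - c 0) * colP t N c I := by
  cases N with
  | zero => simp [colP_zero, sum_crossProd_erase, hN 0 le_rfl]
  | succ N =>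
    simp only [colP_succ, sum_mul, mul_sum]
    -- The sums over j and over the selected set A are exchanged, so that j runs over I \ A. Among
    -- the factors of j with the other points, those from A complete the cross product of A and I \
    -- A, and the rest sum to the t-integer of |I \ A|.
    rw [sum_sigma', sum_congr rfl (g := fun A : Finset ℝ => ∑ j ∈ I \ A,
      (∏ x ∈ A, x) * colP t N (fun j => c (j + 1)) A * crossProd t A ((I.erase j) \ A) *
        crossProd t (I.erase j) {j}), sum_sigma']
    · refine sum_bij' (fun p _ => ⟨p.2, p.1⟩) (fun p _ => ⟨p.2, p.1⟩) ?_ ?_ ?_ ?_ ?_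
      · rintro ⟨j, A⟩ h
        simp only [mem_sigma, mem_powersetCard, Finset.mem_sdiff] at h ⊢
        exact ⟨⟨h.2.1.trans (erase_subset _ _), h.2.2⟩, h.1, fun hj => by
          simpa using h.2.1 hj⟩
      · rintro ⟨A, j⟩ h
        simp only [mem_sigma, mem_powersetCard, Finset.mem_sdiff] at h ⊢
        exact ⟨h.2.1, subset_erase.2 ⟨h.1.1, h.2.2⟩, h.1.2⟩
      · intros; rfl
      · intros; rfl
      · intros; rfl
    · intro A hA
      rw [mem_powersetCard] at hA
      have hcard : (I \ A).card = I.card - c 0 := by rw [card_sdiff_of_subset hA.1, hA.2]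
      rw [← hcard, ← sum_crossProd_erase, sum_mul]
      refine sum_congr rfl fun j hj => ?_
      rw [Finset.mem_sdiff] at hj
      have h1 : I.erase j = A ∪ (I \ A).erase j := by
        ext x; simp only [mem_erase, mem_union, Finset.mem_sdiff]
        constructor
        · rintro ⟨h, h'⟩; by_cases hx : x ∈ A <;> simp [*]
        · rintro (h | h)
          · exact ⟨fun e => hj.2 (e ▸ h), hA.1 h⟩
          · exact ⟨h.1, h.2.1⟩
      have h2 : (I.erase j) \ A = (I \ A).erase j := by
        ext x; simp only [mem_erase, Finset.mem_sdiff]; tauto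
      have h3 : I \ A = insert j ((I \ A).erase j) := by
        rw [insert_erase]; simpa using hj
      have h4 : crossProd t A (I \ A) = crossProd t A {j} * crossProd t A ((I \ A).erase j) := by
        conv_lhs => rw [h3]
        rw [crossProd_insert_right t (by simp)]
      rw [h2, h4, h1, crossProd_union_left]
      · ring
      · exact disjoint_of_subset_right (erase_subset _ _) disjoint_sdiff

/-! ### The branching rule at distinct points -/

/-- Translation of a set of columns by one. -/
def shift (T : Finset ℕ) : Finset ℕ := T.map (addRightEmbedding 1)

lemma succ_mem_shift {T : Finset ℕ} {j : ℕ} : j + 1 ∈ shift T ↔ j ∈ T := by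
  simp [shift]

lemma zero_notMem_shift (T : Finset ℕ) : 0 ∉ shift T := by simp [shift]

lemma card_shift (T : Finset ℕ) : (shift T).card = T.card := by simp [shift]

lemma forall_mem_shift {T : Finset ℕ} {p : ℕ → Prop} :
    (∀ j ∈ shift T, p j) ↔ ∀ j ∈ T, p (j + 1) := by
  simp [shift]

lemma prod_shift {M : Type*} [CommMonoid M] (T : Finset ℕ) (f : ℕ → M) :
    ∏ j ∈ shift T, f j = ∏ j ∈ T, f (j + 1) := by
  simp [shift]

lemma sum_powerset_range_succ {M : Type*} [AddCommMonoid M] (N : ℕ) (f : Finset ℕ → M) :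
    ∑ T ∈ (range (N + 1)).powerset, f T =
      ∑ T ∈ (range N).powerset, f (shift T) + ∑ T ∈ (range N).powerset, f (insert 0 (shift T)) := by
  have h : range (N + 1) = insert 0 (shift (range N)) := by
    ext j
    cases j with
    | zero => simp
    | succ j => simp [succ_mem_shift]
  have h2 : (shift (range N)).powerset = (range N).powerset.image shift := by
    ext T
    simp only [mem_powerset, mem_image]
    constructor
    · intro hT
      refine ⟨T.preimage (· + 1) (add_left_injective 1).injOn, fun j hj => ?_, ?_⟩
      · simpa [succ_mem_shift] using hT (mem_preimage.1 hj)
      · ext j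
        cases j with
        | zero =>
          exact ⟨fun h => absurd h (zero_notMem_shift _),
            fun h => absurd (hT h) (zero_notMem_shift _)⟩
        | succ j => rw [succ_mem_shift, Finset.mem_preimage]
    · rintro ⟨S, hS, rfl⟩
      exact map_subset_map.2 hS
  have h3 : Set.InjOn shift ((range N).powerset : Set (Finset ℕ)) :=
    fun a _ b _ h => map_injective _ h
  rw [h, sum_powerset_insert (zero_notMem_shift _), h2, sum_image h3, sum_image h3]

/-- Removal of one box from each of the columns in `T`. -/
def removeCols (c : ℕ → ℕ) (T : Finset ℕ) : ℕ → ℕ := fun j => c j - if j ∈ T then 1 else 0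

/-- The branching coefficient `ψ_{λ/μ}(t)`, where `λ` has the columns `c` and `μ` is obtained from
`λ` by removal of a horizontal strip with boxes in the columns `T ⊆ {0, …, N - 1}`. -/
def stripWeight (t : ℝ) (N : ℕ) (c : ℕ → ℕ) (T : Finset ℕ) : ℝ :=
  ∏ j ∈ range N, if j ∉ T ∧ j + 1 ∈ T then 1 - t ^ (c j - c (j + 1) + 1) else 1

lemma stripWeight_shift (t : ℝ) (N : ℕ) (c : ℕ → ℕ) (T : Finset ℕ) :
    stripWeight t (N + 1) c (shift T) = (if 0 ∈ T then 1 - t ^ (c 0 - c 1 + 1) else 1) *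
      stripWeight t N (fun j => c (j + 1)) T := by
  rw [stripWeight, prod_range_succ', stripWeight, mul_comm]
  simp [succ_mem_shift, zero_notMem_shift]

lemma stripWeight_insert_shift (t : ℝ) (N : ℕ) (c : ℕ → ℕ) (T : Finset ℕ) :
    stripWeight t (N + 1) c (insert 0 (shift T)) = stripWeight t N (fun j => c (j + 1)) T := by
  rw [stripWeight, prod_range_succ', stripWeight, mul_comm]
  simp [succ_mem_shift]

/-- The part of the branching sum in which a box of the first column is removed (`s = true`),
or is not removed (`s = false`). -/
def stripSum (t : ℝ) (N : ℕ) (c : ℕ → ℕ) (z : ℝ) (s : Bool) (I : Finset ℝ) : ℝ :=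
  ∑ T ∈ (range N).powerset, if (∀ j ∈ T, 0 < c j) ∧ (0 ∈ T ↔ s = true) then
    stripWeight t N c T * z ^ T.card * colP t N (removeCols c T) I else 0

lemma stripSum_add (t : ℝ) (N : ℕ) (c : ℕ → ℕ) (z : ℝ) (I : Finset ℝ) :
    stripSum t N c z false I + stripSum t N c z true I =
      ∑ T ∈ (range N).powerset, if ∀ j ∈ T, 0 < c j then
        stripWeight t N c T * z ^ T.card * colP t N (removeCols c T) I else 0 := by
  rw [stripSum, stripSum, ← sum_add_distrib]
  refine sum_congr rfl fun T _ => ?_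
  by_cases h1 : ∀ j ∈ T, 0 < c j <;> by_cases h2 : 0 ∈ T <;> simp [h1, h2]

lemma removeCols_shift_succ (c : ℕ → ℕ) (T : Finset ℕ) :
    (fun j => removeCols c (shift T) (j + 1)) = removeCols (fun j => c (j + 1)) T := by
  funext j
  simp [removeCols, succ_mem_shift]

lemma removeCols_insert_shift_succ (c : ℕ → ℕ) (T : Finset ℕ) :
    (fun j => removeCols c (insert 0 (shift T)) (j + 1)) = removeCols (fun j => c (j + 1)) T := by
  funext j
  simp [removeCols, succ_mem_shift]

/-- When the first column keeps its box, its local factor 1 - t^(c 0 - c 1 + 1) occurs exactly if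
the second column loses one. When the first column loses its box, as in `stripSum_succ_true`, both
cases have factor 1. -/
lemma stripSum_succ_false (t : ℝ) (N : ℕ) (c : ℕ → ℕ) (z : ℝ) (I : Finset ℝ) :
    stripSum t (N + 1) c z false I = ∑ A ∈ I.powersetCard (c 0), (∏ x ∈ A, x) *
      (stripSum t N (fun j => c (j + 1)) z false A +
        (1 - t ^ (c 0 - c 1 + 1)) * stripSum t N (fun j => c (j + 1)) z true A) *
      crossProd t A (I \ A) := by
  have e : ∀ A : Finset ℝ, stripSum t N (fun j => c (j + 1)) z false A +
        (1 - t ^ (c 0 - c 1 + 1)) * stripSum t N (fun j => c (j + 1)) z true A =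
      ∑ T ∈ (range N).powerset, if ∀ j ∈ T, 0 < c (j + 1) then
        stripWeight t (N + 1) c (shift T) * z ^ T.card *
          colP t N (removeCols (fun j => c (j + 1)) T) A else 0 := by
    intro A
    rw [stripSum, stripSum, mul_sum, ← sum_add_distrib]
    refine sum_congr rfl fun T _ => ?_
    rw [stripWeight_shift]
    by_cases h1 : ∀ j ∈ T, 0 < c (j + 1) <;> by_cases h2 : 0 ∈ T <;> simp [h1, h2]
    ring_nf
  simp only [e]
  rw [stripSum, sum_powerset_range_succ]
  simp only [mem_insert_self, true_iff, Bool.false_eq_true, and_false, if_false, sum_const_zero,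
    add_zero, zero_notMem_shift, and_true, iff_self, forall_mem_shift, mul_sum, sum_mul]
  rw [sum_comm]
  refine sum_congr rfl fun T _ => ?_
  split_ifs with h
  · rw [colP_succ, removeCols_shift_succ, mul_sum, card_shift]
    simp only [removeCols, zero_notMem_shift, if_false, tsub_zero]
    refine sum_congr rfl fun A _ => ?_
    ring
  · simp

lemma stripSum_succ_true (t : ℝ) (N : ℕ) (c : ℕ → ℕ) (z : ℝ) (I : Finset ℝ) (h0 : 0 < c 0) :
    stripSum t (N + 1) c z true I = ∑ A ∈ I.powersetCard (c 0 - 1), z * (∏ x ∈ A, x) *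
      (stripSum t N (fun j => c (j + 1)) z false A +
        stripSum t N (fun j => c (j + 1)) z true A) * crossProd t A (I \ A) := by
  simp only [stripSum_add]
  rw [stripSum, sum_powerset_range_succ]
  simp only [mem_insert_self, and_true, zero_notMem_shift, false_iff, not_true,
    and_false, if_false, sum_const_zero, zero_add, forall_mem_insert, h0, true_and,
    forall_mem_shift, mul_sum, sum_mul]
  rw [sum_comm]
  refine sum_congr rfl fun T _ => ?_
  split_ifs with h
  · rw [colP_succ, removeCols_insert_shift_succ, mul_sum,
      card_insert_of_notMem (zero_notMem_shift _), card_shift, stripWeight_insert_shift]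
    simp only [removeCols, mem_insert_self, if_true]
    refine sum_congr rfl fun A _ => ?_
    ring
  · simp

lemma stripSum_true_eq_zero (t : ℝ) (N : ℕ) (c : ℕ → ℕ) (z : ℝ) (I : Finset ℝ) (h0 : c 0 = 0) :
    stripSum t N c z true I = 0 := by
  refine sum_eq_zero fun T _ => if_neg fun h => ?_
  exact (h.1 0 (h.2.2 rfl)).ne' h0

/-- `sum_colP_erase` depends on the columns only through the length of the first one, which is
constant on each of the two parts. This is why the branching sum is split by the flag `s`. -/
lemma sum_stripSum_erase (t : ℝ) (N : ℕ) (c : ℕ → ℕ) (hN : ∀ j, N ≤ j → c j = 0) (z : ℝ) (s : Bool)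
    (I : Finset ℝ) :
    ∑ j ∈ I, stripSum t N c z s (I.erase j) * crossProd t (I.erase j) {j} =
      tInt t (I.card - (c 0 - if s then 1 else 0)) * stripSum t N c z s I := by
  simp only [stripSum, sum_mul, mul_sum]
  rw [sum_comm]
  refine sum_congr rfl fun T _ => ?_
  split_ifs with h h' h'
  · rw [h', iff_true_intro rfl, iff_true] at h
    have := sum_colP_erase t N (removeCols c T) (fun j hj => by simp [removeCols, hN j hj]) I
    simp only [removeCols, h.2, if_true] at this
    simp only [mul_assoc, ← mul_sum]
    rw [this]
    ring
  · have h0 : 0 ∉ T := fun h0 => h' (h.2.1 h0)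
    have := sum_colP_erase t N (removeCols c T) (fun j hj => by simp [removeCols, hN j hj]) I
    simp only [removeCols, h0, if_false] at this
    simp only [mul_assoc, ← mul_sum]
    rw [this]
    ring
  all_goals simp

/-- The identity which moves the branching rule from `N` to `N + 1` columns. -/
lemma colP_mul_crossProd (t : ℝ) (N : ℕ) (c : ℕ → ℕ) (hN : ∀ j, N ≤ j → c j = 0)
    (ih : ∀ (z : ℝ) (I : Finset ℝ), z ∉ I → colP t N c (insert z I) =
      stripSum t N c z false I + stripSum t N c z true I)
    (z : ℝ) (A : Finset ℝ) (hz : z ∉ A) (hA : c 0 ≤ A.card) :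
    colP t N c A * crossProd t A {z} = stripSum t N c z false A +
      (1 - t ^ (A.card - c 0 + 1)) * stripSum t N c z true A +
      ∑ j ∈ A, (1 - t) * z / (j - z) * colP t N c (insert z (A.erase j)) *
        crossProd t (A.erase j) {j} := by
  -- The term j = z of this sum is the left side of the claim. In the terms with j in A, the factor
  -- (z - tj)/(z - j) is split as t - (1 - t)z/(j - z), and only the part with t is expanded by the
  -- branching rule. The coefficients come from [m+1] - t[m] = 1 and [m+1] - t[m+1] = 1 - t^(m+1).
  have h1 := sum_colP_erase t N c hN (insert z A)
  rw [sum_insert hz, erase_insert hz, ih z A hz, card_insert_of_notMem hz] at h1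
  have h2 : ∑ j ∈ A, colP t N c ((insert z A).erase j) * crossProd t ((insert z A).erase j) {j} =
      t * ∑ j ∈ A, (stripSum t N c z false (A.erase j) + stripSum t N c z true (A.erase j)) *
        crossProd t (A.erase j) {j} -
      ∑ j ∈ A, (1 - t) * z / (j - z) * colP t N c (insert z (A.erase j)) *
        crossProd t (A.erase j) {j} := by
    rw [mul_sum, ← sum_sub_distrib]
    refine sum_congr rfl fun j hj => ?_
    have hjz : z ≠ j := fun h => hz (h ▸ hj)
    have h4 : j - z ≠ 0 := sub_ne_zero.2 hjz.symm
    have hz' : z ∉ A.erase j := by simp [hz]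
    rw [erase_insert_of_ne hjz, crossProd_insert_left t hz',
      crossProd_singleton_left t z {j}, prod_singleton, ← ih z _ hz']
    have h3 : z - j = -(j - z) := by ring
    rw [h3]
    field_simp
    ring
  rw [h2] at h1
  simp only [add_mul, sum_add_distrib] at h1
  rw [sum_stripSum_erase t N c hN, sum_stripSum_erase t N c hN] at h1
  simp only [Bool.false_eq_true, if_false, if_true, tsub_zero] at h1
  have e1 : A.card + 1 - c 0 = A.card - c 0 + 1 := by omega
  rw [e1, tInt_succ'] at h1
  -- For c 0 = 0 the truncated subtraction gives the wrong t-integer, but then no box of the first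
  -- column can be removed and the part vanishes.
  have e2 : t * tInt t (A.card - (c 0 - 1)) * stripSum t N c z true A =
      (t * tInt t (A.card - c 0) + t ^ (A.card - c 0 + 1)) * stripSum t N c z true A := by
    rcases Nat.eq_zero_or_pos (c 0) with h0 | h0
    · rw [stripSum_true_eq_zero t N c z A h0, mul_zero, mul_zero]
    · have e3 : A.card - (c 0 - 1) = A.card - c 0 + 1 := by omega
      rw [e3, tInt_succ]
      ring
  linear_combination h1 - e2

lemma powersetCard_insert_sum {z : ℝ} {I : Finset ℝ} (hz : z ∉ I) (n : ℕ)
    (f : Finset ℝ → ℝ) :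
    ∑ A ∈ (insert z I).powersetCard (n + 1), f A =
      ∑ A ∈ I.powersetCard (n + 1), f A + ∑ A ∈ I.powersetCard n, f (insert z A) := by
  rw [powersetCard_succ_insert hz, sum_union, sum_image]
  · intro A hA B hB h
    have hA' : z ∉ A := fun h => hz ((mem_powersetCard.1 hA).1 h)
    have hB' : z ∉ B := fun h => hz ((mem_powersetCard.1 hB).1 h)
    rw [← erase_insert hA', h, erase_insert hB']
  · rw [disjoint_left]
    intro A hA hA'
    obtain ⟨B, _, rfl⟩ := mem_image.1 hA'
    exact hz ((mem_powersetCard.1 hA).1 (mem_insert_self _ _))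

/-- Pairs of a set `A` with `n + 1` elements and an element of it, as pairs of a set with `n`
elements and an element outside. -/
lemma sum_powersetCard_succ_erase (I : Finset ℝ) (n : ℕ) (f : Finset ℝ → ℝ → ℝ) :
    ∑ A ∈ I.powersetCard (n + 1), ∑ j ∈ A, f (A.erase j) j =
      ∑ B ∈ I.powersetCard n, ∑ j ∈ I \ B, f B j := by
  rw [sum_sigma', sum_sigma']
  refine sum_bij' (fun p _ => ⟨p.1.erase p.2, p.2⟩) (fun p _ => ⟨insert p.2 p.1, p.2⟩) ?_ ?_ ?_ ?_ ?_
  · rintro ⟨A, j⟩ h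
    simp only [mem_sigma, mem_powersetCard, Finset.mem_sdiff] at h ⊢
    refine ⟨⟨(erase_subset _ _).trans h.1.1, ?_⟩, h.1.1 h.2, by simp⟩
    rw [card_erase_of_mem h.2, h.1.2, Nat.add_sub_cancel]
  · rintro ⟨A, j⟩ h
    simp only [mem_sigma, mem_powersetCard, Finset.mem_sdiff] at h ⊢
    refine ⟨⟨insert_subset h.2.1 h.1.1, ?_⟩, mem_insert_self _ _⟩
    rw [card_insert_of_notMem h.2.2, h.1.2]
  · rintro ⟨A, j⟩ h
    simp only [mem_sigma] at h
    simp [insert_erase h.2]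
  · rintro ⟨A, j⟩ h
    simp only [mem_sigma, Finset.mem_sdiff] at h
    simp [erase_insert h.2.2]
  · intros; rfl

/-- The selected sets are split by membership of z. If z is not selected, `colP_mul_crossProd` for
the remaining columns yields the part where the first column keeps its box, plus error terms indexed
by an element j of A. If A = B ∪ {z}, partial fractions of the cross product of z with I \ B yield
the part where the first column loses its box, plus terms indexed by j outside B. Under A \ {j} = B
the two families cancel. -/
theorem colP_insert (t : ℝ) (N : ℕ) (c : ℕ → ℕ) (hc : Antitone c) (hN : ∀ j, N ≤ j → c j = 0)
    (z : ℝ) (I : Finset ℝ) (hz : z ∉ I) :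
    colP t N c (insert z I) = stripSum t N c z false I + stripSum t N c z true I := by
  induction N generalizing c z I with
  | zero => simp [colP_zero, stripSum, stripWeight]
  | succ N ih =>
    have hc' : Antitone fun j => c (j + 1) := fun i j h => hc (by omega)
    have hN' : ∀ j, N ≤ j → c (j + 1) = 0 := fun j hj => hN _ (by omega)
    have ih' := ih _ hc' hN'
    have key := colP_mul_crossProd t N (fun j => c (j + 1)) hN' ih' z
    have h10 : c 1 ≤ c 0 := hc (by omega)
    rcases Nat.eq_zero_or_pos (c 0) with h0 | h0
    · rw [stripSum_true_eq_zero _ _ _ _ _ h0, stripSum_succ_false, colP_succ, h0]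
      simp only [powersetCard_zero, sum_singleton, sdiff_empty, crossProd_empty_left, prod_empty,
        one_mul, mul_one, add_zero]
      rw [stripSum_true_eq_zero _ _ _ _ _ (by show c (0 + 1) = 0; simp; omega)]
      have := key ∅ (by simp) (by simp; omega)
      rw [stripSum_true_eq_zero _ _ _ _ _ (by show c (0 + 1) = 0; simp; omega),
        crossProd_empty_left] at this
      simpa using this
    · obtain ⟨n, hn⟩ : ∃ n, c 0 = n + 1 := ⟨c 0 - 1, by omega⟩
      rw [stripSum_succ_false, stripSum_succ_true _ _ _ _ _ h0, colP_succ, hn,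
        powersetCard_insert_sum hz, Nat.add_sub_cancel]
      set c' := fun j => c (j + 1) with hcdef
      have e1 : ∑ A ∈ I.powersetCard (n + 1),
            (∏ x ∈ A, x) * colP t N c' A * crossProd t A (insert z I \ A) =
          ∑ A ∈ I.powersetCard (n + 1), (∏ x ∈ A, x) * (stripSum t N c' z false A +
              (1 - t ^ (n + 1 - c 1 + 1)) * stripSum t N c' z true A) * crossProd t A (I \ A) +
          ∑ A ∈ I.powersetCard (n + 1), ∑ j ∈ A, (∏ x ∈ A.erase j, x) * j *
            ((1 - t) * z / (j - z)) * colP t N c' (insert z (A.erase j)) *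
            (crossProd t {j} ((I \ A.erase j).erase j) *
              crossProd t (A.erase j) (I \ A.erase j)) := by
        rw [← sum_add_distrib]
        refine sum_congr rfl fun A hA => ?_
        rw [mem_powersetCard] at hA
        have hzA : z ∉ A := fun h => hz (hA.1 h)
        have hs : insert z I \ A = insert z (I \ A) := insert_sdiff_of_notMem _ hzA
        rw [hs, crossProd_insert_right t (by simp [hz])]
        have k := key A hzA (by rw [hA.2, ← hn]; exact h10)
        rw [hA.2] at k
        have k2 : (∏ x ∈ A, x) * colP t N c' A * (crossProd t A {z} * crossProd t A (I \ A)) =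
          (∏ x ∈ A, x) * (colP t N c' A * crossProd t A {z}) * crossProd t A (I \ A) := by ring
        rw [k2, k, mul_add, add_mul]
        congr 1
        rw [mul_sum, sum_mul]
        refine sum_congr rfl fun j hj => ?_
        have g1 : I \ A.erase j = insert j (I \ A) := by
          rw [sdiff_erase (hA.1 hj)]
        have hjn : j ∉ I \ A := by simp [hj]
        have g3 : crossProd t A (I \ A) = crossProd t {j} (I \ A) *
            crossProd t (A.erase j) (I \ A) := by
          conv_lhs => rw [← insert_erase hj]
          rw [crossProd_insert_left t (by simp)]
          simp [insert_erase hj]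
        rw [g1, erase_insert hjn, crossProd_insert_right t hjn, g3, ← prod_erase_mul A _ hj]
        ring
      rw [e1, add_assoc]
      congr 1
      -- The error terms are rewritten over pairs of B and j outside B, to meet those from the sets
      -- containing z.
      rw [sum_powersetCard_succ_erase I n (fun B j => (∏ x ∈ B, x) * j *
            ((1 - t) * z / (j - z)) * colP t N c' (insert z B) *
            (crossProd t {j} ((I \ B).erase j) * crossProd t B (I \ B))), ← sum_add_distrib]
      refine sum_congr rfl fun B hB => ?_
      rw [mem_powersetCard] at hB
      have hzB : z ∉ B := fun h => hz (hB.1 h)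
      have hs : insert z I \ insert z B = I \ B := by
        ext x; simp only [Finset.mem_sdiff, mem_insert]
        constructor
        · rintro ⟨h1, h2⟩; push Not at h2; exact ⟨h1.resolve_left h2.1, h2.2⟩
        · rintro ⟨h1, h2⟩; exact ⟨Or.inr h1, by push Not; exact ⟨fun h => hz (h ▸ h1), h2⟩⟩
      rw [hs, crossProd_insert_left t hzB, crossProd_singleton_left_eq t (I \ B) z (by simp [hz]),
        prod_insert hzB, ← ih' z B hzB, add_mul, mul_add, one_mul, add_left_comm, ← add_zero (_ * _)]
      congr 1
      · ring
      · rw [sum_mul, mul_sum, ← sum_add_distrib]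
        refine sum_eq_zero fun j hj => ?_
        have hjz : z ≠ j := fun h => hz (h ▸ (Finset.mem_sdiff.1 hj).1)
        have h4 : j - z ≠ 0 := sub_ne_zero.2 hjz.symm
        have h3 : z - j = -(j - z) := by ring
        rw [h3]
        field_simp
        ring

/-! ### The symmetrization formula at distinct points -/

/-- The sum over permutations in the definition of the Hall-Littlewood polynomials. -/
def symSum (t : ℝ) (n : ℕ) (ρ : ℕ → ℕ) (x : Fin n → ℝ) : ℝ :=
  ∑ σ : Equiv.Perm (Fin n), (∏ i : Fin n, x (σ i) ^ ρ i) *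
    ∏ i : Fin n, ∏ j ∈ Ioi i, (x (σ i) - t * x (σ j)) / (x (σ i) - x (σ j))

/-- The permutation of `Fin (n + 1)` which maps the last element to `p` and is `τ` elsewhere. -/
def extendPerm {n : ℕ} (p : Fin (n + 1)) (τ : Equiv.Perm (Fin n)) : Equiv.Perm (Fin (n + 1)) :=
  (finSuccEquiv' (Fin.last n)).trans ((Equiv.optionCongr τ).trans (finSuccEquiv' p).symm)

lemma extendPerm_last {n : ℕ} (p : Fin (n + 1)) (τ : Equiv.Perm (Fin n)) :
    extendPerm p τ (Fin.last n) = p := by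
  simp [extendPerm]

lemma extendPerm_castSucc {n : ℕ} (p : Fin (n + 1)) (τ : Equiv.Perm (Fin n)) (i : Fin n) :
    extendPerm p τ i.castSucc = p.succAbove (τ i) := by
  have : finSuccEquiv' (Fin.last n) i.castSucc = some i := by
    rw [← Fin.succAbove_last_apply, finSuccEquiv'_succAbove]
  simp [extendPerm, this]

lemma extendPerm_bijective (n : ℕ) :
    Function.Bijective fun q : Fin (n + 1) × Equiv.Perm (Fin n) => extendPerm q.1 q.2 := by
  rw [Fintype.bijective_iff_injective_and_card]
  constructor
  · rintro ⟨p, τ⟩ ⟨p', τ'⟩ h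
    simp only at h
    have h1 : p = p' := by rw [← extendPerm_last p τ, h, extendPerm_last]
    subst h1
    congr 1
    ext i
    have h2 := congrArg (fun σ : Equiv.Perm (Fin (n + 1)) => σ i.castSucc) h
    simp only [extendPerm_castSucc] at h2
    exact congrArg Fin.val (Fin.succAbove_right_injective h2)
  · simp [Fintype.card_perm, Nat.factorial_succ]

lemma prod_prod_Ioi_castSucc {n : ℕ} (f : Fin (n + 1) → Fin (n + 1) → ℝ) :
    ∏ i : Fin (n + 1), ∏ j ∈ Ioi i, f i j =
      (∏ i : Fin n, ∏ j ∈ Ioi i, f i.castSucc j.castSucc) *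
        ∏ i : Fin n, f i.castSucc (Fin.last n) := by
  have h : ∀ (m : ℕ) (i : Fin m) (g : Fin m → ℝ),
      ∏ j ∈ Ioi i, g j = ∏ j, if i < j then g j else 1 := by
    intro m i g
    rw [← prod_filter]
    congr 1
    ext j
    simp
  simp only [h, Fin.prod_univ_castSucc, Fin.castSucc_lt_castSucc_iff, Fin.castSucc_lt_last,
    if_true, prod_mul_distrib, not_lt_of_ge (Fin.le_last _), if_false, prod_const_one, mul_one]

/-- Permutations are grouped by the image p of the last index, whose cross factors with all the
other variables do not depend on the remaining permutation. -/
lemma symSum_succ (t : ℝ) (n : ℕ) (ρ : ℕ → ℕ) (x : Fin (n + 1) → ℝ) :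
    symSum t (n + 1) ρ x = ∑ p : Fin (n + 1), x p ^ ρ n *
      (∏ i : Fin n, (x (p.succAbove i) - t * x p) / (x (p.succAbove i) - x p)) *
      symSum t n ρ (fun i => x (p.succAbove i)) := by
  rw [symSum, ← (Equiv.ofBijective _ (extendPerm_bijective n)).sum_comp, Fintype.sum_prod_type]
  refine sum_congr rfl fun p _ => ?_
  rw [symSum, mul_sum]
  refine sum_congr rfl fun τ _ => ?_
  simp only [Equiv.ofBijective_apply]
  rw [prod_prod_Ioi_castSucc, Fin.prod_univ_castSucc]
  simp only [extendPerm_last, extendPerm_castSucc, Fin.val_last, Fin.val_castSucc]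
  rw [Equiv.prod_comp τ fun i => (x (p.succAbove i) - t * x p) / (x (p.succAbove i) - x p)]
  ring

/-- The `t`-factorial. -/
def tFac (t : ℝ) (n : ℕ) : ℝ := ∏ k ∈ range n, tInt t (k + 1)

lemma tFac_succ (t : ℝ) (n : ℕ) : tFac t (n + 1) = tFac t n * tInt t (n + 1) := by
  rw [tFac, tFac, prod_range_succ]

/-- The product of the `t`-factorials of the multiplicities of `0, …, M - 1` in `ρ`. -/
def multFac (t : ℝ) (n M : ℕ) (ρ : ℕ → ℕ) : ℝ :=
  ∏ i ∈ range M, tFac t (univ.filter fun j : Fin n => ρ j = i).card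

lemma card_filter_castSucc (n : ℕ) (p : ℕ → Prop) [DecidablePred p] :
    (univ.filter fun j : Fin (n + 1) => p j).card =
      (univ.filter fun j : Fin n => p j).card + if p n then 1 else 0 := by
  simp only [card_filter, Fin.sum_univ_castSucc, Fin.val_castSucc, Fin.val_last]

lemma image_succAbove {n : ℕ} (x : Fin (n + 1) → ℝ) (hx : Function.Injective x) (p : Fin (n + 1)) :
    univ.image (fun i => x (p.succAbove i)) = (univ.image x).erase (x p) := by
  ext y
  simp only [mem_image, mem_univ, true_and, mem_erase]
  constructor
  · rintro ⟨i, rfl⟩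
    exact ⟨fun h => Fin.succAbove_ne p i (hx h), _, rfl⟩
  · rintro ⟨hy, i, rfl⟩
    obtain ⟨j, rfl⟩ := Fin.exists_succAbove_eq (x := i) (y := p) fun h => hy (h ▸ rfl)
    exact ⟨j, rfl⟩

lemma conj_antitone {ρ c : ℕ → ℕ} (h : ∀ i j, i < c j ↔ j < ρ i) : Antitone c := by
  intro j k hjk
  by_contra! hlt
  have := (h _ _).1 hlt
  exact lt_irrefl _ ((h _ _).2 (lt_of_le_of_lt hjk this))

/-- The symmetrization formula, when the last exponent vanishes. -/
lemma symSum_eq_step (t : ℝ) (n N : ℕ) (ρ c : ℕ → ℕ) (hconj : ∀ i j, i < c j ↔ j < ρ i)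
    (hN : ∀ j, N ≤ j → c j = 0) (hn : c 0 ≤ n)
    (ih : ∀ x : Fin n → ℝ, Function.Injective x →
      symSum t n ρ x = multFac t n (N + 1) ρ * colP t N c (univ.image x))
    (x : Fin (n + 1) → ℝ) (hx : Function.Injective x) :
    symSum t (n + 1) ρ x = multFac t (n + 1) (N + 1) ρ * colP t N c (univ.image x) := by
  have hz : ∀ i, ρ i = 0 ↔ c 0 ≤ i := fun i => by
    rw [← not_lt, hconj i 0, Nat.pos_iff_ne_zero, not_not]
  have hρn : ρ n = 0 := (hz n).2 hn
  have hcard : (univ.filter fun j : Fin n => ρ j = 0).card = n - c 0 := by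
    simp only [hz, card_filter]
    rw [Fin.sum_univ_eq_sum_range (fun k => if c 0 ≤ k then 1 else 0) n, ← card_filter,
      show (range n).filter (fun k => c 0 ≤ k) = Ico (c 0) n by ext; simp [and_comm], Nat.card_Ico]
  -- Position n has exponent zero, so only the multiplicity of zero changes, from n - c 0 to n + 1 -
  -- c 0. The new factor is the t-integer in `sum_colP_erase`.
  have hmult : multFac t (n + 1) (N + 1) ρ =
      multFac t n (N + 1) ρ * tInt t (n + 1 - c 0) := by
    rw [multFac, multFac, prod_range_succ', prod_range_succ',
      card_filter_castSucc n fun k => ρ k = 0, if_pos hρn, hcard, tFac_succ,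
      Nat.sub_add_comm hn, mul_assoc]
    congr 1
    refine prod_congr rfl fun i _ => ?_
    rw [card_filter_castSucc n fun k => ρ k = i + 1, if_neg (by omega), add_zero]
  have hI : (univ.image x).card = n + 1 := by
    rw [card_image_of_injective _ hx, card_univ, Fintype.card_fin]
  have key := sum_colP_erase t N c hN (univ.image x)
  rw [sum_image hx.injOn, hI] at key
  rw [symSum_succ, hmult, mul_assoc, ← key, mul_sum]
  refine sum_congr rfl fun p _ => ?_
  rw [ih (fun i => x (p.succAbove i)) (hx.comp Fin.succAbove_right_injective), hρn, pow_zero, one_mul,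
    crossProd_singleton_right, ← image_succAbove x hx p,
    prod_image fun i _ j _ h => Fin.succAbove_right_injective (hx h)]
  ring

/-- If the last exponent vanishes, its variable is split off, by induction on n. Otherwise every
exponent is positive, the product of all variables factors out, and a full column is removed from
both sides, by induction on N. -/
theorem symSum_eq (t : ℝ) (n N : ℕ) (ρ c : ℕ → ℕ) (hconj : ∀ i j, i < c j ↔ j < ρ i)
    (hN : ∀ j, N ≤ j → c j = 0) (hn : c 0 ≤ n) (x : Fin n → ℝ) (hx : Function.Injective x) :
    symSum t n ρ x = multFac t n (N + 1) ρ * colP t N c (univ.image x) := by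
  induction n generalizing N ρ c with
  | zero =>
    have hc : ∀ j, c j = 0 := fun j =>
      Nat.le_zero.1 ((conj_antitone hconj (Nat.zero_le j)).trans hn)
    rw [colP_eq_one _ _ _ hc]
    simp [symSum, multFac, tFac]
  | succ n ih =>
    have step := fun (N : ℕ) (ρ c : ℕ → ℕ) (hconj : ∀ i j, i < c j ↔ j < ρ i)
      (hN : ∀ j, N ≤ j → c j = 0) (hn : c 0 ≤ n) => symSum_eq_step t n N ρ c hconj hN hn
        (fun x hx => ih N ρ c hconj hN hn x hx) x hx
    induction N generalizing ρ c with
    | zero => exact step 0 ρ c hconj hN (by simp [hN])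
    | succ N ihN =>
      by_cases hn' : c 0 ≤ n
      · exact step _ ρ c hconj hN hn'
      have hc0 : c 0 = n + 1 := by omega
      have hpos : ∀ i : Fin (n + 1), 0 < ρ i := fun i => (hconj _ _).1 (by omega)
      have hI : (univ.image x).card = n + 1 := by
        rw [card_image_of_injective _ hx, card_univ, Fintype.card_fin]
      have ih' := ihN (fun i => ρ i - 1) (fun j => c (j + 1))
        (fun i j => by rw [hconj]; omega) (fun j hj => hN _ (by omega))
        ((conj_antitone hconj (Nat.zero_le 1)).trans hn)
      have h1 : symSum t (n + 1) ρ x =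
          (∏ y ∈ univ.image x, y) * symSum t (n + 1) (fun i => ρ i - 1) x := by
        rw [symSum, symSum, mul_sum, prod_image hx.injOn]
        refine sum_congr rfl fun σ _ => ?_
        rw [← Equiv.prod_comp σ x, ← mul_assoc]
        congr 1
        rw [← prod_mul_distrib]
        refine prod_congr rfl fun i _ => ?_
        rw [← pow_succ', Nat.sub_add_cancel (hpos i)]
      have h2 : multFac t (n + 1) (N + 1 + 1) ρ =
          multFac t (n + 1) (N + 1) (fun i => ρ i - 1) := by
        rw [multFac, prod_range_succ', multFac]
        have : (univ.filter fun j : Fin (n + 1) => ρ j = 0) = ∅ :=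
          filter_eq_empty_iff.2 fun i _ => (hpos i).ne'
        rw [this, card_empty, tFac, prod_range_zero, mul_one]
        refine prod_congr rfl fun k _ => ?_
        congr 2
        ext i
        have := hpos i
        simp only [mem_filter, mem_univ, true_and]
        omega
      have h3 : powersetCard (n + 1) (univ.image x) = {univ.image x} := by
        have := powersetCard_self (univ.image x)
        rwa [hI] at this
      rw [h1, ih', h2, colP_succ, hc0, h3, sum_singleton, Finset.sdiff_self, crossProd_empty_right]
      ring

/-! ### The Hall-Littlewood polynomials at distinct points -/

/-- The Vandermonde product. -/
def vdm (n : ℕ) : MvPolynomial (Fin n) ℝ :=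
  ∏ i : Fin n, ∏ j ∈ Ioi i, (MvPolynomial.X i - MvPolynomial.X j)

lemma vdm_ne_zero (n : ℕ) : vdm n ≠ 0 :=
  prod_ne_zero_iff.2 fun _ _ => prod_ne_zero_iff.2 fun _ hj => X_sub_X_ne_zero (mem_Ioi.1 hj).ne

lemma eval_vdm {n : ℕ} (x : Fin n → ℝ) :
    MvPolynomial.eval x (vdm n) = ∏ i : Fin n, ∏ j ∈ Ioi i, (x i - x j) := by
  simp [vdm, map_prod]

lemma eval_vdm_eq_zero {n : ℕ} (x : Fin n → ℝ) (hx : ¬ Function.Injective x) :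
    MvPolynomial.eval x (vdm n) = 0 := by
  rw [eval_vdm]
  simp only [Function.Injective, not_forall] at hx
  obtain ⟨i, j, h, hij⟩ := hx
  rcases lt_or_gt_of_ne hij with hlt | hlt
  · exact prod_eq_zero (mem_univ i) (prod_eq_zero (mem_Ioi.2 hlt) (sub_eq_zero.2 h))
  · exact prod_eq_zero (mem_univ j) (prod_eq_zero (mem_Ioi.2 hlt) (sub_eq_zero.2 h.symm))

/-- Polynomials which agree at all points with distinct coordinates are equal. -/
lemma eq_of_eval_eq_of_injective {n : ℕ} {p q : MvPolynomial (Fin n) ℝ}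
    (h : ∀ x : Fin n → ℝ, Function.Injective x → MvPolynomial.eval x p = MvPolynomial.eval x q) :
    p = q := by
  refine mul_left_cancel₀ (vdm_ne_zero n) (MvPolynomial.funext fun x => ?_)
  rw [map_mul, map_mul]
  by_cases hx : Function.Injective x
  · rw [h x hx]
  · rw [eval_vdm_eq_zero x hx, zero_mul, zero_mul]

lemma qPochhammer_div_pow (t : ℝ) (ht : t ≠ 1) (m : ℕ) :
    qPochhammer t t m / (1 - t) ^ m = tFac t m := by
  have h1 : 1 - t ≠ 0 := sub_ne_zero.2 ht.symm
  rw [qPochhammer, tFac, div_eq_iff (pow_ne_zero _ h1)]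
  rw [← card_range m, ← prod_const, card_range, ← prod_mul_distrib]
  refine prod_congr rfl fun k _ => ?_
  rw [tInt_mul, pow_succ']

lemma one_sub_pow_pos {t : ℝ} (ht : |t| < 1) (k : ℕ) : 0 < 1 - t ^ (k + 1) := by
  have h1 : |t| ^ (k + 1) < 1 := pow_lt_one₀ (abs_nonneg t) ht (by omega)
  have h2 : t ^ (k + 1) ≤ |t| ^ (k + 1) := by rw [← abs_pow]; exact le_abs_self _
  linarith

lemma qPochhammer_pos {t : ℝ} (ht : |t| < 1) (m : ℕ) : 0 < qPochhammer t t m :=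
  prod_pos fun k _ => by rw [← pow_succ']; exact one_sub_pow_pos ht k

lemma V_eq_multFac (t : ℝ) (ht : t ≠ 1) (n : ℕ) (μ : YoungDiagram) :
    V t n μ = multFac t n (μ.rowLen 0 + 1) μ.rowLen :=
  prod_congr rfl fun _ _ => qPochhammer_div_pow t ht _

lemma V_ne_zero {t : ℝ} (ht : |t| < 1) (n : ℕ) (μ : YoungDiagram) : V t n μ ≠ 0 := by
  refine prod_ne_zero_iff.2 fun _ _ => div_ne_zero (qPochhammer_pos ht _).ne' (pow_ne_zero _ ?_)
  linarith [(abs_lt.1 ht).2]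

/-- `polyP` is known only through its image in the field of fractions. Multiplication by the
Vandermonde product, on which σ acts by its sign, gives an identity of polynomials that can be
evaluated at points. -/
lemma C_mul_vdm_mul_polyP {t : ℝ} (ht : |t| < 1) (n : ℕ) (μ : YoungDiagram) (hn : μ.colLen 0 ≤ n) :
    MvPolynomial.C (V t n μ) * vdm n * polyP t n μ = antisymNum t n μ := by
  set φ := algebraMap (MvPolynomial (Fin n) ℝ) (FractionRing (MvPolynomial (Fin n) ℝ)) with hφ
  have hinj : Function.Injective φ := IsFractionRing.injective _ _
  apply hinj
  have hP : φ (polyP t n μ) = ratP t n μ := by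
    rw [polyP, if_pos hn]
    exact Classical.choose_spec (exists_polynomial t n μ)
  have hC : φ (MvPolynomial.C (V t n μ)) = ratC n (V t n μ) := rfl
  have hC0 : ratC n (V t n μ) ≠ 0 := by
    rw [← hC, Ne, map_eq_zero_iff _ hinj, MvPolynomial.C_eq_zero]
    exact V_ne_zero ht n μ
  have hD : φ (vdm n) = ∏ i : Fin n, ∏ j ∈ Ioi i, (ratX i - ratX j) := by
    simp only [vdm, map_prod, map_sub]
    rfl
  have hD0 : φ (vdm n) ≠ 0 := by
    rw [Ne, map_eq_zero_iff _ hinj]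
    exact vdm_ne_zero n
  rw [map_mul, map_mul, hP, hC, ratP, mul_comm (ratC n _), mul_assoc, mul_inv_cancel_left₀ hC0,
    antisymNum, map_sum, mul_sum]
  refine sum_congr rfl fun σ _ => ?_
  have hσ := σ.prod_Ioi_comp_eq_sign_mul_prod
    (f := fun i j => (ratX i - ratX j : FractionRing (MvPolynomial (Fin n) ℝ)))
    (fun i j => by ring)
  have hs : (((Equiv.Perm.sign σ : ℤ) : FractionRing (MvPolynomial (Fin n) ℝ))) *
      ((Equiv.Perm.sign σ : ℤ) : FractionRing (MvPolynomial (Fin n) ℝ)) = 1 := by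
    rw [← Int.cast_mul, ← Units.val_mul, Int.units_mul_self]
    simp
  have hs0 : ((Equiv.Perm.sign σ : ℤ) : FractionRing (MvPolynomial (Fin n) ℝ)) ≠ 0 :=
    left_ne_zero_of_mul_eq_one hs
  simp only [prod_div_distrib]
  rw [hσ, ← hD]
  simp only [map_mul, map_intCast, map_prod, map_pow, map_sub]
  have e1 : ∀ i : Fin n, φ (MvPolynomial.X i) = ratX i := fun _ => rfl
  have e2 : φ (MvPolynomial.C t) = ratC n t := rfl
  simp only [e1, e2]
  field_simp
  rw [pow_two, hs, mul_one]

lemma V_mul_P {t : ℝ} (ht : |t| < 1) {n : ℕ} (μ : YoungDiagram) (hn : μ.colLen 0 ≤ n)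
    (x : Fin n → ℝ) (hx : Function.Injective x) :
    V t n μ * P t μ x = symSum t n μ.rowLen x := by
  have h := congrArg (MvPolynomial.eval x) (C_mul_vdm_mul_polyP ht n μ hn)
  have hD0 : ∏ i : Fin n, ∏ j ∈ Ioi i, (x i - x j) ≠ 0 :=
    prod_ne_zero_iff.2 fun i _ => prod_ne_zero_iff.2 fun j hj =>
      sub_ne_zero.2 fun e => (mem_Ioi.1 hj).ne (hx e)
  rw [map_mul, map_mul, MvPolynomial.eval_C, eval_vdm, mul_right_comm, ← eq_div_iff hD0] at h
  rw [P, h, antisymNum, map_sum, sum_div, symSum]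
  refine sum_congr rfl fun σ _ => ?_
  have hσ := σ.prod_Ioi_comp_eq_sign_mul_prod (f := fun i j => x i - x j) (fun i j => by ring)
  have hs : ((Equiv.Perm.sign σ : ℤ) : ℝ) * ((Equiv.Perm.sign σ : ℤ) : ℝ) = 1 := by
    rw [← Int.cast_mul, ← Units.val_mul, Int.units_mul_self]
    simp
  have hs0 : ((Equiv.Perm.sign σ : ℤ) : ℝ) ≠ 0 := left_ne_zero_of_mul_eq_one hs
  simp only [prod_div_distrib]
  rw [hσ]
  simp only [map_mul, map_intCast, map_prod, map_pow, map_sub, MvPolynomial.eval_X,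
    MvPolynomial.eval_C]
  field_simp
  rw [pow_two, hs, one_mul]

lemma lt_colLen_iff (μ : YoungDiagram) (i j : ℕ) : i < μ.colLen j ↔ j < μ.rowLen i := by
  rw [← YoungDiagram.mem_iff_lt_colLen, YoungDiagram.mem_iff_lt_rowLen]

lemma colLen_eq_zero {μ : YoungDiagram} {j : ℕ} : μ.colLen j = 0 ↔ μ.rowLen 0 ≤ j := by
  rw [← not_lt, ← lt_colLen_iff, Nat.pos_iff_ne_zero, not_not]

lemma colP_fuel (t : ℝ) (N M : ℕ) (hNM : N ≤ M) (c : ℕ → ℕ) (hN : ∀ j, N ≤ j → c j = 0)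
    (I : Finset ℝ) : colP t M c I = colP t N c I := by
  induction N generalizing M c I with
  | zero => rw [colP_zero, colP_eq_one _ _ _ fun j => hN j (Nat.zero_le _)]
  | succ N ih =>
    obtain ⟨M, rfl⟩ : ∃ k, M = k + 1 := ⟨M - 1, by omega⟩
    rw [colP_succ, colP_succ]
    refine sum_congr rfl fun A _ => ?_
    rw [ih M (by omega) _ fun j hj => hN _ (by omega)]

/-- Any bound N on the number of columns is allowed, so that a diagram and those obtained from it by
removing strips can be compared at the same recursion depth. With too few variables both sides
vanish. -/
theorem P_eq_colP {t : ℝ} (ht : |t| < 1) (μ : YoungDiagram) (N : ℕ) (hN : μ.rowLen 0 ≤ N) {n : ℕ}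
    (x : Fin n → ℝ) (hx : Function.Injective x) :
    P t μ x = colP t N μ.colLen (univ.image x) := by
  have hN' : ∀ j, μ.rowLen 0 ≤ j → μ.colLen j = 0 := fun j hj => colLen_eq_zero.2 hj
  rw [colP_fuel t (μ.rowLen 0) N hN _ hN']
  by_cases hn : μ.colLen 0 ≤ n
  · refine mul_left_cancel₀ (V_ne_zero ht n μ) ?_
    rw [V_mul_P ht μ hn x hx, V_eq_multFac t (by rintro rfl; simp at ht),
      symSum_eq t n (μ.rowLen 0) μ.rowLen μ.colLen (lt_colLen_iff μ) hN' hn x hx]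
  · rw [P, polyP, if_neg hn, map_zero, colP_eq_zero_of_card_lt _ _ _ hN']
    rw [card_image_of_injective _ hx, card_univ, Fintype.card_fin]
    omega

/-! ### Young diagrams and horizontal strips -/

lemma colLen_antitone (μ : YoungDiagram) : Antitone μ.colLen := fun i j h => μ.colLen_anti i j h

lemma eq_of_colLen_eq {μ ν : YoungDiagram} (h : ∀ j, μ.colLen j = ν.colLen j) : μ = ν := by
  refine SetLike.ext fun p => ?_
  obtain ⟨i, j⟩ := p
  rw [YoungDiagram.mem_iff_lt_colLen, YoungDiagram.mem_iff_lt_colLen, h]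

/-- The Young diagram with columns `f 0, …, f (N - 1)`, for antitone `f`. -/
def ofCols (f : ℕ → ℕ) (N : ℕ) : YoungDiagram where
  -- The condition on all columns up to the given one makes this a lower set even for `f` that is
  -- not antitone.
  cells := (range (f 0) ×ˢ range N).filter fun p => ∀ k ≤ p.2, p.1 < f k
  isLowerSet := by
    rintro ⟨i, j⟩ ⟨i', j'⟩ h hp
    obtain ⟨h1 : i' ≤ i, h2 : j' ≤ j⟩ := h
    simp only [coe_filter, mem_product, mem_range, Set.mem_ofPred_eq] at hp ⊢
    exact ⟨⟨by omega, by omega⟩, fun k hk => h1.trans_lt (hp.2 k (hk.trans h2))⟩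

lemma colLen_ofCols {f : ℕ → ℕ} {N : ℕ} (hf : Antitone f) (hN : ∀ j, N ≤ j → f j = 0) (j : ℕ) :
    (ofCols f N).colLen j = f j := by
  have : ∀ i, i < (ofCols f N).colLen j ↔ i < f j := by
    intro i
    rw [← YoungDiagram.mem_iff_lt_colLen, ← YoungDiagram.mem_cells]
    simp only [ofCols, mem_filter, mem_product, mem_range]
    constructor
    · exact fun h => h.2 j le_rfl
    · intro h
      refine ⟨⟨h.trans_le (hf (Nat.zero_le j)), ?_⟩, fun k hk => h.trans_le (hf hk)⟩
      by_contra! hj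
      rw [hN j hj] at h
      omega
  exact le_antisymm (le_of_not_gt fun h => lt_irrefl _ ((this _).1 h))
    (le_of_not_gt fun h => lt_irrefl _ ((this _).2 h))

lemma card_eq_sum_colLen (μ : YoungDiagram) (N : ℕ) (hN : μ.rowLen 0 ≤ N) :
    μ.card = ∑ j ∈ range N, μ.colLen j := by
  rw [YoungDiagram.card, card_eq_sum_card_fiberwise (f := Prod.snd) (t := range N)]
  · refine sum_congr rfl fun j _ => ?_
    rw [YoungDiagram.colLen_eq_card]
    rfl
  · rintro ⟨i, j⟩ h
    have h1 : j < μ.rowLen i := YoungDiagram.mem_iff_lt_rowLen.1 h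
    have h2 := μ.rowLen_anti 0 i (Nat.zero_le i)
    simp only [coe_range, Set.mem_Iio]
    omega

lemma rowLen_zero_le_card (μ : YoungDiagram) : μ.rowLen 0 ≤ μ.card := by
  rw [card_eq_sum_colLen μ _ le_rfl]
  calc μ.rowLen 0 = ∑ j ∈ range (μ.rowLen 0), 1 := by simp
    _ ≤ _ := sum_le_sum fun j hj => (lt_colLen_iff μ 0 j).2 (mem_range.1 hj)

/-- A horizontal strip with boxes in the columns in `T` can be removed from `lam`. -/
def IsStrip (lam : YoungDiagram) (T : Finset ℕ) : Prop :=
  (∀ j ∈ T, 0 < lam.colLen j) ∧ Antitone (removeCols lam.colLen T)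

/-- The diagram obtained by removal of a horizontal strip. -/
def removeStrip (lam : YoungDiagram) (T : Finset ℕ) : YoungDiagram :=
  ofCols (removeCols lam.colLen T) (lam.rowLen 0)

open scoped Classical in
/-- The horizontal strips which can be removed from `lam`. -/
def strips (lam : YoungDiagram) : Finset (Finset ℕ) :=
  (range (lam.rowLen 0)).powerset.filter (IsStrip lam)

/-- The branching coefficient `ψ_{λ/μ}(t)`. -/
def psi (t : ℝ) (lam : YoungDiagram) (T : Finset ℕ) : ℝ :=
  stripWeight t (lam.rowLen 0) lam.colLen T

lemma IsStrip.subset {lam : YoungDiagram} {T : Finset ℕ} (h : IsStrip lam T) :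
    T ⊆ range (lam.rowLen 0) := fun j hj => by
  simpa using (lt_colLen_iff lam 0 j).1 (h.1 j hj)

lemma mem_strips {lam : YoungDiagram} {T : Finset ℕ} : T ∈ strips lam ↔ IsStrip lam T := by
  classical
  rw [strips, mem_filter, mem_powerset, and_iff_right_of_imp IsStrip.subset]

lemma colLen_removeStrip {lam : YoungDiagram} {T : Finset ℕ} (h : IsStrip lam T) (j : ℕ) :
    (removeStrip lam T).colLen j = lam.colLen j - if j ∈ T then 1 else 0 :=
  colLen_ofCols h.2 (fun j hj => by simp [removeCols, colLen_eq_zero.2 hj]) j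

lemma rowLen_removeStrip_le {lam : YoungDiagram} {T : Finset ℕ} (h : IsStrip lam T) :
    (removeStrip lam T).rowLen 0 ≤ lam.rowLen 0 := by
  rw [← colLen_eq_zero, colLen_removeStrip h, colLen_eq_zero.2 le_rfl, zero_tsub]

lemma card_removeStrip {lam : YoungDiagram} {T : Finset ℕ} (h : IsStrip lam T) :
    (removeStrip lam T).card + T.card = lam.card := by
  have e : T.card = ∑ j ∈ range (lam.rowLen 0), if j ∈ T then 1 else 0 := by
    rw [sum_ite_mem, inter_eq_right.2 h.subset, card_eq_sum_ones]
  rw [card_eq_sum_colLen _ _ (rowLen_removeStrip_le h), card_eq_sum_colLen _ _ le_rfl, e,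
    ← sum_add_distrib]
  refine sum_congr rfl fun j _ => ?_
  rw [colLen_removeStrip h]
  split_ifs with hj
  · have := h.1 j hj; omega
  · simp

lemma stripWeight_eq_psi (t : ℝ) {lam : YoungDiagram} {T : Finset ℕ}
    (h : T ⊆ range (lam.rowLen 0)) (N : ℕ) (hN : lam.rowLen 0 ≤ N) :
    stripWeight t N lam.colLen T = psi t lam T := by
  rw [psi, stripWeight, stripWeight]
  symm
  refine prod_subset (range_subset_range.2 hN) fun j _ hj => if_neg fun hT => hj ?_
  have := mem_range.1 (h hT.2)
  rw [mem_range]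
  omega

open scoped Classical in
lemma sum_strips {M : Type*} [AddCommMonoid M] (lam : YoungDiagram) (N : ℕ)
    (hN : lam.rowLen 0 ≤ N) (f : Finset ℕ → M) :
    ∑ T ∈ strips lam, f T =
      ∑ T ∈ (range N).powerset, if IsStrip lam T then f T else 0 := by
  rw [← sum_filter]
  congr 1
  ext T
  rw [mem_strips, mem_filter, mem_powerset, and_iff_right_of_imp]
  exact fun h => h.subset.trans (range_subset_range.2 hN)

lemma removeCols_empty (c : ℕ → ℕ) : removeCols c ∅ = c := by
  funext j
  simp [removeCols]

lemma isStrip_empty (lam : YoungDiagram) : IsStrip lam ∅ :=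
  ⟨by simp, by rw [removeCols_empty]; exact colLen_antitone lam⟩

lemma removeStrip_empty (lam : YoungDiagram) : removeStrip lam ∅ = lam :=
  eq_of_colLen_eq fun j => by simp [colLen_removeStrip (isStrip_empty lam)]

lemma psi_empty (t : ℝ) (lam : YoungDiagram) : psi t lam ∅ = 1 := by
  simp [psi, stripWeight]

/-! ### Branching rule, symmetry and homogeneity -/

lemma P_branching_of_injective {t : ℝ} (ht : |t| < 1) (lam : YoungDiagram) {n : ℕ}
    (y : Fin (n + 1) → ℝ) (hy : Function.Injective y) :
    P t lam y = ∑ T ∈ strips lam, psi t lam T * y (Fin.last n) ^ T.card *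
      P t (removeStrip lam T) (fun i : Fin n => y i.castSucc) := by
  have hN' : ∀ j, lam.rowLen 0 ≤ j → lam.colLen j = 0 := fun j hj => colLen_eq_zero.2 hj
  have hx : Function.Injective fun i : Fin n => y i.castSucc :=
    fun i j h => Fin.castSucc_injective n (hy h)
  have himg : univ.image y = insert (y (Fin.last n)) (univ.image fun i : Fin n => y i.castSucc) := by
    ext v
    simp only [mem_image, mem_univ, true_and, mem_insert]
    constructor
    · rintro ⟨i, rfl⟩
      induction i using Fin.lastCases with
      | last => exact Or.inl rfl
      | cast i => exact Or.inr ⟨i, rfl⟩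
    · rintro (rfl | ⟨i, rfl⟩)
      · exact ⟨_, rfl⟩
      · exact ⟨_, rfl⟩
  have hz : y (Fin.last n) ∉ univ.image fun i : Fin n => y i.castSucc := by
    simp only [mem_image, mem_univ, true_and, not_exists]
    exact fun i h => (Fin.castSucc_lt_last i).ne (hy h)
  rw [P_eq_colP ht lam _ le_rfl y hy, himg, colP_insert t _ _ (colLen_antitone lam) hN' _ _ hz,
    stripSum_add]
  classical
  rw [sum_strips lam _ le_rfl]
  refine sum_congr rfl fun T _ => ?_
  by_cases h : IsStrip lam T
  · rw [if_pos h.1, if_pos h, P_eq_colP ht _ _ (rowLen_removeStrip_le h) _ hx]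
    congr 2
    funext j
    rw [colLen_removeStrip h]
    rfl
  · rw [if_neg h]
    split_ifs with h1
    -- Here the removal of T does not leave a partition, so the term contributes nothing.
    · rw [colP_eq_zero_of_not_antitone, mul_zero]
      · intro j hj
        simp [removeCols, hN' j hj]
      · exact fun h2 => h ⟨h1, h2⟩
    · rfl

/-- The branching rule. -/
theorem P_branching {t : ℝ} (ht : |t| < 1) (lam : YoungDiagram) {n : ℕ} (y : Fin (n + 1) → ℝ) :
    P t lam y = ∑ T ∈ strips lam, psi t lam T * y (Fin.last n) ^ T.card *
      P t (removeStrip lam T) (fun i : Fin n => y i.castSucc) := by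
  have h := eq_of_eval_eq_of_injective (p := polyP t (n + 1) lam)
    (q := ∑ T ∈ strips lam, MvPolynomial.C (psi t lam T) * MvPolynomial.X (Fin.last n) ^ T.card *
      MvPolynomial.rename Fin.castSucc (polyP t n (removeStrip lam T))) fun x hx => by
    simp only [map_sum, map_mul, map_pow, MvPolynomial.eval_C, MvPolynomial.eval_X,
      MvPolynomial.eval_rename]
    exact P_branching_of_injective ht lam x hx
  rw [P, h]
  simp only [map_sum, map_mul, map_pow, MvPolynomial.eval_C, MvPolynomial.eval_X,
      MvPolynomial.eval_rename]
  rfl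

/-- At distinct points `colP` depends only on the set of values, not on their order. -/
lemma P_comp_equiv {t : ℝ} (ht : |t| < 1) (μ : YoungDiagram) {m n : ℕ} (e : Fin m ≃ Fin n)
    (x : Fin n → ℝ) : P t μ (fun i => x (e i)) = P t μ x := by
  obtain rfl : m = n := by simpa using Fintype.card_congr e
  have h := eq_of_eval_eq_of_injective (p := MvPolynomial.rename e (polyP t m μ))
    (q := polyP t m μ) fun x hx => by
    rw [MvPolynomial.eval_rename]
    have h1 := P_eq_colP ht μ _ le_rfl (x ∘ e) (hx.comp e.injective)
    have h2 := P_eq_colP ht μ _ le_rfl x hx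
    rw [P] at h1 h2
    rw [h1, h2]
    congr 1
    ext v
    simp only [mem_image, mem_univ, true_and, Function.comp_apply]
    exact e.exists_congr_left.trans (by simp)
  have h2 := congrArg (MvPolynomial.eval x) h
  rw [MvPolynomial.eval_rename] at h2
  exact h2

lemma P_append_comm {t : ℝ} (ht : |t| < 1) (μ : YoungDiagram) {m n : ℕ} (x : Fin m → ℝ)
    (y : Fin n → ℝ) : P t μ (Fin.append x y) = P t μ (Fin.append y x) := by
  rw [← P_comp_equiv ht μ finAddFlip (Fin.append y x)]
  congr 1
  funext i
  induction i using Fin.addCases with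
  | left i => simp
  | right i => simp

lemma P_append_right {t : ℝ} (ht : |t| < 1) (lam : YoungDiagram) {m n : ℕ} (x : Fin m → ℝ)
    (y : Fin (n + 1) → ℝ) :
    P t lam (Fin.append x y) = ∑ T ∈ strips lam, psi t lam T * y (Fin.last n) ^ T.card *
      P t (removeStrip lam T) (Fin.append x fun i : Fin n => y i.castSucc) := by
  refine (P_branching ht lam (@Fin.append m (n + 1) ℝ x y)).trans ?_
  refine sum_congr rfl fun T _ => ?_
  have h1 : Fin.append x y (Fin.last (m + n)) = y (Fin.last n) :=
    Fin.append_right x y (Fin.last n)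
  have h2 : (fun i : Fin (m + n) => Fin.append x y (Fin.castSucc (n := m + n) i)) =
      Fin.append x fun i : Fin n => y i.castSucc := by
    funext i
    induction i using Fin.addCases with
    | left i =>
      rw [Fin.append_left]
      exact Fin.append_left x y i
    | right i =>
      rw [Fin.append_right]
      exact Fin.append_right x y i.castSucc
  exact congrArg₂ (fun a b => psi t lam T * a ^ T.card * P t (removeStrip lam T) b) h1 h2

lemma P_append_left {t : ℝ} (ht : |t| < 1) (lam : YoungDiagram) {m n : ℕ} (x : Fin (m + 1) → ℝ)
    (y : Fin n → ℝ) :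
    P t lam (Fin.append x y) = ∑ T ∈ strips lam, psi t lam T * x (Fin.last m) ^ T.card *
      P t (removeStrip lam T) (Fin.append (fun i : Fin m => x i.castSucc) y) := by
  rw [P_append_comm ht, P_append_right ht]
  refine sum_congr rfl fun T _ => ?_
  rw [P_append_comm ht]

lemma card_bot : (⊥ : YoungDiagram).card = 0 := rfl

lemma colLen_bot (j : ℕ) : (⊥ : YoungDiagram).colLen j = 0 := by
  have h := rowLen_zero_le_card ⊥
  rw [card_bot] at h
  exact colLen_eq_zero.2 (h.trans (Nat.zero_le j))

open scoped Classical in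
lemma P_zero {t : ℝ} (ht : |t| < 1) (μ : YoungDiagram) (x : Fin 0 → ℝ) :
    P t μ x = if μ = ⊥ then 1 else 0 := by
  rw [P_eq_colP ht μ _ le_rfl x fun i => i.elim0]
  split_ifs with h
  · subst h
    exact colP_eq_one _ _ _ colLen_bot _
  · refine colP_eq_zero_of_card_lt _ _ _ (fun j hj => colLen_eq_zero.2 hj) _ ?_
    simp only [univ_eq_empty, image_empty, card_empty]
    by_contra h0
    refine h (eq_of_colLen_eq fun j => ?_)
    rw [colLen_bot]
    have := colLen_antitone μ (Nat.zero_le j)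
    omega

lemma P_bot {t : ℝ} (ht : |t| < 1) {n : ℕ} (x : Fin n → ℝ) : P t ⊥ x = 1 := by
  have h := eq_of_eval_eq_of_injective (p := polyP t n ⊥) (q := 1) fun x hx => by
    rw [map_one]
    exact (P_eq_colP ht ⊥ _ le_rfl x hx).trans (colP_eq_one _ _ _ colLen_bot _)
  rw [P, h, map_one]

lemma P_mul_left {t : ℝ} (ht : |t| < 1) (μ : YoungDiagram) {n : ℕ} (u : ℝ) (x : Fin n → ℝ) :
    P t μ (fun i => u * x i) = u ^ μ.card * P t μ x := by
  induction n generalizing μ with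
  | zero =>
    rw [P_zero ht, P_zero ht]
    split_ifs with h
    · rw [h, card_bot]; simp
    · simp
  | succ n ih =>
    rw [P_branching ht, P_branching ht, mul_sum]
    refine sum_congr rfl fun T hT => ?_
    rw [ih, ← card_removeStrip (mem_strips.1 hT)]
    ring

/-! ### Principal specializations -/

/-- The geometric progression `{1, t, …, t^(n-1)}`. -/
def geomSet (t : ℝ) (n : ℕ) : Finset ℝ := (range n).image fun i => t ^ i

lemma pow_inj_of_abs_lt_one {t : ℝ} (ht : |t| < 1) (h0 : t ≠ 0) :
    Function.Injective fun i : ℕ => t ^ i := by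
  intro i j h
  have h1 : |t| ^ i = |t| ^ j := by rw [← abs_pow, ← abs_pow]; exact congrArg _ h
  exact (pow_right_injective₀ (abs_pos.2 h0) ht.ne) h1

lemma qPochhammer_succ (t : ℝ) (n : ℕ) :
    qPochhammer t t (n + 1) = qPochhammer t t n * (1 - t ^ (n + 1)) := by
  rw [qPochhammer, prod_range_succ, ← pow_succ', qPochhammer]

lemma pow_sub_pow_eq (t : ℝ) {i n : ℕ} (h : i ≤ n) : t ^ i - t ^ n = t ^ i * (1 - t ^ (n - i)) := by
  rw [mul_sub, mul_one, ← pow_add, Nat.add_sub_cancel' h]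

/-- The i-th factor equals (1 - t^(n+1-i)) / (1 - t^(n-i)). -/
lemma prod_telescope {t : ℝ} (ht : |t| < 1) (h0 : t ≠ 0) (n c : ℕ) (hc : c ≤ n) :
    (∏ i ∈ range c, (t ^ i - t * t ^ n) / (t ^ i - t ^ n)) * (1 - t ^ (n + 1 - c)) =
      1 - t ^ (n + 1) := by
  induction c with
  | zero => simp
  | succ c ih =>
    have ih := ih (by omega)
    rw [prod_range_succ]
    generalize ∏ i ∈ range c, (t ^ i - t * t ^ n) / (t ^ i - t ^ n) = p at ih ⊢
    rw [← pow_succ', pow_sub_pow_eq t (by omega : c ≤ n + 1),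
      pow_sub_pow_eq t (by omega : c ≤ n), ← ih]
    have e : n + 1 - (c + 1) = n - c := by omega
    have h1 : 1 - t ^ (n - c) ≠ 0 := by
      obtain ⟨k, hk⟩ : ∃ k, n - c = k + 1 := ⟨n - c - 1, by omega⟩
      rw [hk]
      exact (one_sub_pow_pos ht k).ne'
    rw [e]
    field_simp

lemma geomSet_subset (t : ℝ) {m n : ℕ} (h : m ≤ n) : geomSet t m ⊆ geomSet t n :=
  image_subset_image (range_subset_range.2 h)

lemma card_geomSet {t : ℝ} (ht : |t| < 1) (h0 : t ≠ 0) (n : ℕ) : (geomSet t n).card = n := by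
  rw [geomSet, card_image_of_injective _ (pow_inj_of_abs_lt_one ht h0), card_range]

lemma pow_mem_geomSet {t : ℝ} (ht : |t| < 1) (h0 : t ≠ 0) {i n : ℕ} :
    t ^ i ∈ geomSet t n ↔ i < n := by
  rw [geomSet, mem_image]
  constructor
  · rintro ⟨j, hj, h⟩
    rw [← pow_inj_of_abs_lt_one ht h0 h]
    exact mem_range.1 hj
  · exact fun h => ⟨i, mem_range.2 h, rfl⟩

lemma crossProd_geomSet {t : ℝ} (ht : |t| < 1) (h0 : t ≠ 0) (c n : ℕ) (hc : c ≤ n) :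
    crossProd t (geomSet t c) (geomSet t n \ geomSet t c) *
      (qPochhammer t t c * qPochhammer t t (n - c)) = qPochhammer t t n := by
  induction n, hc using Nat.le_induction with
  | base => simp [crossProd, qPochhammer]
  | succ n hc ih =>
    have h1 : t ^ n ∉ geomSet t c := fun h => by
      rw [pow_mem_geomSet ht h0] at h
      omega
    have h2 : t ^ n ∉ geomSet t n := fun h => by
      rw [pow_mem_geomSet ht h0] at h
      omega
    have h3 : geomSet t (n + 1) \ geomSet t c = insert (t ^ n) (geomSet t n \ geomSet t c) := by
      rw [geomSet, range_add_one, image_insert, insert_sdiff_of_notMem _ h1]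
      rfl
    have h4 : crossProd t (geomSet t c) {t ^ n} =
        ∏ i ∈ range c, (t ^ i - t * t ^ n) / (t ^ i - t ^ n) := by
      rw [crossProd_singleton_right, geomSet, prod_image (pow_inj_of_abs_lt_one ht h0).injOn]
    have e : n + 1 - c = n - c + 1 := by omega
    rw [h3, crossProd_insert_right t (by simp [h2]), qPochhammer_succ, ← ih, e, qPochhammer_succ,
      ← prod_telescope ht h0 n c hc, h4, e]
    ring

lemma eq_range_of_lower {K : Finset ℕ} (h : ∀ k, k + 1 ∈ K → k ∈ K) : K = range K.card := by
  have h' : ∀ d k, k + d ∈ K → k ∈ K := by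
    intro d
    induction d with
    | zero => exact fun k hk => hk
    | succ d ih => exact fun k hk => ih k (h _ hk)
  refine eq_of_subset_of_card_le (fun k hk => ?_) (by simp)
  have : range (k + 1) ⊆ K := fun i hi => by
    refine h' (k - i) i ?_
    rw [mem_range] at hi
    rwa [Nat.add_sub_cancel' (by omega)]
  have := card_le_card this
  rw [card_range] at this
  exact mem_range.2 this

/-- If A is not an initial segment of the progression, then for some k it contains t^(k+1) but not
t^k, and the factor with numerator t^(k+1) - t · t^k vanishes. -/
lemma crossProd_eq_zero_of_ne_geomSet {t : ℝ} (ht : |t| < 1) (h0 : t ≠ 0) (n : ℕ) (A : Finset ℝ)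
    (hA : A ⊆ geomSet t n) (h : A ≠ geomSet t A.card) :
    crossProd t A (geomSet t n \ A) = 0 := by
  have hinj := pow_inj_of_abs_lt_one ht h0
  set K := (range n).filter fun i => t ^ i ∈ A with hK
  have hAK : A = K.image fun i => t ^ i := by
    ext x
    rw [mem_image]
    constructor
    · intro hx
      obtain ⟨i, hi, rfl⟩ := mem_image.1 (hA hx)
      exact ⟨i, mem_filter.2 ⟨hi, hx⟩, rfl⟩
    · rintro ⟨i, hi, rfl⟩
      exact (mem_filter.1 hi).2
  have hcard : K.card = A.card := by
    rw [hAK, card_image_of_injective _ hinj]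
  by_contra hne
  refine h ?_
  rw [← hcard, geomSet, ← eq_range_of_lower]
  · exact hAK
  · intro k hk
    rw [mem_filter, mem_range] at hk
    by_contra hk'
    have hkA : t ^ k ∉ A := fun h => hk' (mem_filter.2 ⟨mem_range.2 (by omega), h⟩)
    refine hne (prod_eq_zero hk.2 (prod_eq_zero (i := t ^ k) ?_ ?_))
    · rw [Finset.mem_sdiff, pow_mem_geomSet ht h0]
      exact ⟨by omega, hkA⟩
    · rw [← pow_succ', sub_self, zero_div]

lemma prod_geomSet {t : ℝ} (ht : |t| < 1) (h0 : t ≠ 0) (n : ℕ) :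
    ∏ x ∈ geomSet t n, x = t ^ n.choose 2 := by
  rw [geomSet, prod_image (pow_inj_of_abs_lt_one ht h0).injOn, prod_pow_eq_pow_sum,
    sum_range_id, Nat.choose_two_right]

/-- Each column can only select an initial segment, so a single term survives at every stage. Its
cross product is a t-binomial coefficient by `crossProd_geomSet`, and these telescope along the
columns. -/
lemma colP_geomSet {t : ℝ} (ht : |t| < 1) (h0 : t ≠ 0) (N : ℕ) (c : ℕ → ℕ) (hc : Antitone c)
    (hN : ∀ j, N ≤ j → c j = 0) (n : ℕ) (hn : c 0 ≤ n) :
    colP t N c (geomSet t n) * (qPochhammer t t (n - c 0) *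
      ∏ j ∈ range N, qPochhammer t t (c j - c (j + 1))) =
      t ^ (∑ j ∈ range N, (c j).choose 2) * qPochhammer t t n := by
  induction N generalizing c n with
  | zero => simp [colP_zero, hN 0 le_rfl]
  | succ N ih =>
    have ih' := ih (fun j => c (j + 1)) (fun i j h => hc (by omega)) (fun j hj => hN _ (by omega))
      (c 0) (hc (Nat.zero_le 1))
    rw [colP_succ, sum_eq_single (geomSet t (c 0)), prod_geomSet ht h0, prod_range_succ',
      sum_range_succ', ← crossProd_geomSet ht h0 _ _ hn, pow_add]
    · linear_combination (t ^ (c 0).choose 2 * qPochhammer t t (n - c 0) *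
        crossProd t (geomSet t (c 0)) (geomSet t n \ geomSet t (c 0))) * ih'
    · intro A hA hne
      rw [mem_powersetCard] at hA
      rw [crossProd_eq_zero_of_ne_geomSet ht h0 n A hA.1 (by rwa [hA.2]), mul_zero]
    · intro h
      exact absurd (mem_powersetCard.2 ⟨geomSet_subset t hn, card_geomSet ht h0 _⟩) h

/-- The statistic `n(μ) = ∑ (i - 1) μ_i`. -/
def nStat (μ : YoungDiagram) : ℕ := ∑ j ∈ range (μ.rowLen 0), (μ.colLen j).choose 2

/-- The normalization `b_μ(t) = ∏_{i ≥ 1} (t; t)_{m_i(μ)}`. -/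
def bNorm (t : ℝ) (μ : YoungDiagram) : ℝ :=
  ∏ j ∈ range (μ.rowLen 0), qPochhammer t t (μ.colLen j - μ.colLen (j + 1))

lemma bNorm_pos {t : ℝ} (ht : |t| < 1) (μ : YoungDiagram) : 0 < bNorm t μ :=
  prod_pos fun _ _ => qPochhammer_pos ht _

lemma P_geom {t : ℝ} (ht : |t| < 1) (h0 : t ≠ 0) (μ : YoungDiagram) (k : ℕ) :
    bNorm t μ * P t μ (fun i : Fin (k + μ.colLen 0) => t ^ (i : ℕ)) =
      t ^ nStat μ * ∏ i ∈ range (μ.colLen 0), (1 - t ^ (k + i + 1)) := by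
  have himg : (univ.image fun i : Fin (k + μ.colLen 0) => t ^ (i : ℕ)) =
      geomSet t (k + μ.colLen 0) := by
    ext x
    simp only [geomSet, mem_image, mem_univ, true_and, mem_range]
    exact ⟨fun ⟨i, h⟩ => ⟨i, i.2, h⟩, fun ⟨i, hi, h⟩ => ⟨⟨i, hi⟩, h⟩⟩
  have h1 := colP_geomSet ht h0 (μ.rowLen 0) μ.colLen (colLen_antitone μ)
    (fun j hj => colLen_eq_zero.2 hj) (k + μ.colLen 0) (Nat.le_add_left _ _)
  have h2 : ∀ m, qPochhammer t t (k + m) =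
      qPochhammer t t k * ∏ i ∈ range m, (1 - t ^ (k + i + 1)) := by
    intro m
    induction m with
    | zero => simp
    | succ m ih => rw [← add_assoc, qPochhammer_succ, ih, prod_range_succ, mul_assoc]
  rw [← himg, ← P_eq_colP ht μ _ le_rfl _
    (fun i j h => Fin.ext (pow_inj_of_abs_lt_one ht h0 h)), h2, Nat.add_sub_cancel] at h1
  refine mul_left_cancel₀ (qPochhammer_pos ht k).ne' ?_
  rw [bNorm, nStat]
  linear_combination h1

lemma tendsto_P_geom {t : ℝ} (ht : |t| < 1) (h0 : t ≠ 0) (μ : YoungDiagram) :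
    Tendsto (fun n : ℕ => P t μ fun i : Fin n => t ^ (i : ℕ)) atTop
      (𝓝 (t ^ nStat μ / bNorm t μ)) := by
  rw [← tendsto_add_atTop_iff_nat (μ.colLen 0)]
  have h : (fun k => P t μ fun i : Fin (k + μ.colLen 0) => t ^ (i : ℕ)) = fun k =>
      t ^ nStat μ * (∏ i ∈ range (μ.colLen 0), (1 - t ^ (k + i + 1))) / bNorm t μ := by
    funext k
    rw [eq_div_iff (bNorm_pos ht μ).ne', ← P_geom ht h0, mul_comm]
  rw [h]
  refine Tendsto.div_const ?_ _
  have h1 : ∀ i ∈ range (μ.colLen 0),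
      Tendsto (fun k : ℕ => 1 - t ^ (k + i + 1)) atTop (𝓝 (1 - 0)) := fun i _ => by
    refine tendsto_const_nhds.sub ?_
    have := (tendsto_pow_atTop_nhds_zero_of_abs_lt_one ht)
    exact (tendsto_add_atTop_iff_nat (i + 1)).2 this
  simpa using (tendsto_finsetProd _ h1).const_mul (t ^ nStat μ)

lemma mult_succ (μ : YoungDiagram) (i : ℕ) : mult μ (i + 1) = μ.colLen i - μ.colLen (i + 1) := by
  have h : ∀ n, ((List.range n).map μ.rowLen).count (i + 1) =
      ((range n).filter fun k => μ.rowLen k = i + 1).card := by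
    intro n
    induction n with
    | zero => simp
    | succ n ih =>
      rw [List.range_succ, List.map_append, List.count_append, ih, range_add_one, filter_insert]
      split_ifs with h
      · rw [card_insert_of_notMem (by simp)]
        simp [h]
      · simp [h]
  rw [mult, YoungDiagram.rowLens, h,
    show (range (μ.colLen 0)).filter (fun k => μ.rowLen k = i + 1) =
      Ico (μ.colLen (i + 1)) (μ.colLen i) from ?_, Nat.card_Ico]
  ext k
  have h1 := lt_colLen_iff μ k i
  have h2 := lt_colLen_iff μ k (i + 1)
  have h3 := colLen_antitone μ (Nat.zero_le i)
  simp only [mem_filter, mem_range, mem_Ico]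
  omega

lemma bNorm_eq (t : ℝ) (μ : YoungDiagram) :
    ∏ i ∈ Icc 1 (μ.rowLen 0), qPochhammer t t (mult μ i) = bNorm t μ := by
  rw [bNorm, show Icc 1 (μ.rowLen 0) = Ico 1 (μ.rowLen 0 + 1) by ext; simp,
    prod_Ico_eq_prod_range]
  refine prod_congr rfl fun j _ => ?_
  rw [add_comm 1 j, mult_succ]

lemma tendsto_Q_geom {t : ℝ} (ht : |t| < 1) (h0 : t ≠ 0) (μ : YoungDiagram) :
    Tendsto (fun n : ℕ => Q t μ fun i : Fin n => t ^ (i : ℕ)) atTop (𝓝 (t ^ nStat μ)) := by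
  have h := (tendsto_P_geom ht h0 μ).const_mul (bNorm t μ)
  rw [mul_div_cancel₀ _ (bNorm_pos ht μ).ne'] at h
  refine h.congr fun n => ?_
  rw [Q, bNorm_eq]

/-- The value of `P_μ(t, t², …; t)`. -/
def pVal (t : ℝ) (μ : YoungDiagram) : ℝ := t ^ (μ.card + nStat μ) / bNorm t μ

lemma pVal_ne_zero {t : ℝ} (ht : |t| < 1) (h0 : t ≠ 0) (μ : YoungDiagram) : pVal t μ ≠ 0 :=
  div_ne_zero (pow_ne_zero _ h0) (bNorm_pos ht μ).ne'

lemma tendsto_P_geom_succ {t : ℝ} (ht : |t| < 1) (h0 : t ≠ 0) (μ : YoungDiagram) :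
    Tendsto (fun n : ℕ => P t μ fun i : Fin n => t ^ ((i : ℕ) + 1)) atTop (𝓝 (pVal t μ)) := by
  have h := (tendsto_P_geom ht h0 μ).const_mul (t ^ μ.card)
  rw [← mul_div_assoc, ← pow_add] at h
  refine h.congr fun n => ?_
  rw [← P_mul_left ht]
  simp only [pow_succ']

/-! ### Generating functions of sets of columns -/

/-- The weight of a set `T` of columns, with a factor `w j` for each `j ∈ T` and with a factor
`g j` for each `j < N` which depends on membership of `j` and `j + 1`. -/
def colsWeight (N : ℕ) (w : ℕ → ℝ) (g : ℕ → Bool → Bool → ℝ) (T : Finset ℕ) : ℝ :=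
  (∏ j ∈ T, w j) * ∏ j ∈ range N, g j (decide (j ∈ T)) (decide (j + 1 ∈ T))

/-- Part of the generating function of sets of columns, with prescribed membership of `0`. -/
def colsGenPart (N : ℕ) (w : ℕ → ℝ) (g : ℕ → Bool → Bool → ℝ) (s : Bool) : Polynomial ℝ :=
  ∑ T ∈ (range N).powerset, if decide (0 ∈ T) = s then
    Polynomial.C (colsWeight N w g T) * Polynomial.X ^ T.card else 0

/-- The generating function of sets of columns. -/
def colsGen (N : ℕ) (w : ℕ → ℝ) (g : ℕ → Bool → Bool → ℝ) : Polynomial ℝ :=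
  ∑ T ∈ (range N).powerset, Polynomial.C (colsWeight N w g T) * Polynomial.X ^ T.card

lemma colsGen_eq (N : ℕ) (w : ℕ → ℝ) (g : ℕ → Bool → Bool → ℝ) :
    colsGen N w g = colsGenPart N w g false + colsGenPart N w g true := by
  rw [colsGen, colsGenPart, colsGenPart, ← sum_add_distrib]
  refine sum_congr rfl fun T _ => ?_
  by_cases h : 0 ∈ T <;> simp [h]

lemma colsGenPart_zero (w : ℕ → ℝ) (g : ℕ → Bool → Bool → ℝ) (s : Bool) :
    colsGenPart 0 w g s = if s then 0 else 1 := by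
  cases s <;> simp [colsGenPart, colsWeight]

lemma colsGenPart_succ_false (N : ℕ) (w : ℕ → ℝ) (g : ℕ → Bool → Bool → ℝ) :
    colsGenPart (N + 1) w g false =
      Polynomial.C (g 0 false false) *
        colsGenPart N (fun j => w (j + 1)) (fun j => g (j + 1)) false +
      Polynomial.C (g 0 false true) *
        colsGenPart N (fun j => w (j + 1)) (fun j => g (j + 1)) true := by
  simp only [colsGenPart]
  rw [sum_powerset_range_succ, mul_sum, mul_sum]
  simp only [zero_notMem_shift, mem_insert_self, decide_true, decide_false, if_true,
    Bool.true_eq_false, if_false]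
  rw [sum_const_zero, add_zero, ← sum_add_distrib]
  refine sum_congr rfl fun T _ => ?_
  have h : colsWeight (N + 1) w g (shift T) = g 0 false (decide (0 ∈ T)) *
      colsWeight N (fun j => w (j + 1)) (fun j => g (j + 1)) T := by
    rw [colsWeight, prod_range_succ', colsWeight, prod_shift]
    simp only [succ_mem_shift, zero_notMem_shift, decide_false]
    ring
  rw [h, card_shift]
  by_cases h0 : 0 ∈ T <;> simp [h0, mul_assoc]

lemma colsGenPart_succ_true (N : ℕ) (w : ℕ → ℝ) (g : ℕ → Bool → Bool → ℝ) :
    colsGenPart (N + 1) w g true = Polynomial.C (w 0) * Polynomial.X *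
      (Polynomial.C (g 0 true false) *
        colsGenPart N (fun j => w (j + 1)) (fun j => g (j + 1)) false +
      Polynomial.C (g 0 true true) *
        colsGenPart N (fun j => w (j + 1)) (fun j => g (j + 1)) true) := by
  simp only [colsGenPart]
  rw [sum_powerset_range_succ, mul_sum, mul_sum]
  simp only [zero_notMem_shift, mem_insert_self, decide_true, decide_false, if_true,
    Bool.false_eq_true, if_false]
  rw [sum_const_zero, zero_add, ← sum_add_distrib, mul_sum]
  refine sum_congr rfl fun T _ => ?_
  have h : colsWeight (N + 1) w g (insert 0 (shift T)) = w 0 * (g 0 true (decide (0 ∈ T)) *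
      colsWeight N (fun j => w (j + 1)) (fun j => g (j + 1)) T) := by
    rw [colsWeight, prod_range_succ', colsWeight, prod_insert (zero_notMem_shift T), prod_shift]
    simp only [succ_mem_shift, mem_insert, decide_true, true_or, Nat.add_eq_zero_iff, one_ne_zero,
      and_false, false_or]
    ring
  rw [h, card_insert_of_notMem (zero_notMem_shift T), card_shift]
  by_cases h0 : 0 ∈ T <;> simp [h0] <;> ring

/-- The factor `1 - m j` when `j ∉ T` and `j + 1 ∈ T`. -/
def enterFactor (m : ℕ → ℝ) (j : ℕ) (p q : Bool) : ℝ := if !p && q then 1 - m j else 1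

/-- The factor `1 - n j` when `j ∈ T` and `j + 1 ∉ T`. -/
def exitFactor (n : ℕ → ℝ) (j : ℕ) (p q : Bool) : ℝ := if p && !q then 1 - n j else 1

lemma colsGenPart_enter_false (N : ℕ) (w m : ℕ → ℝ) :
    colsGenPart (N + 1) w (enterFactor m) false =
      colsGen N (fun j => w (j + 1)) (enterFactor fun j => m (j + 1)) - Polynomial.C (m 0) *
        colsGenPart N (fun j => w (j + 1)) (enterFactor fun j => m (j + 1)) true := by
  have e : enterFactor (fun j => m (j + 1)) = fun j => enterFactor m (j + 1) := rfl
  rw [colsGenPart_succ_false, colsGen_eq, e]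
  simp only [enterFactor, Bool.not_false, Bool.true_and, Bool.false_eq_true, if_false, if_true,
    Polynomial.C_1, Polynomial.C_sub]
  ring

lemma colsGenPart_enter_true (N : ℕ) (w m : ℕ → ℝ) :
    colsGenPart (N + 1) w (enterFactor m) true = Polynomial.C (w 0) * Polynomial.X *
      colsGen N (fun j => w (j + 1)) (enterFactor fun j => m (j + 1)) := by
  have e : enterFactor (fun j => m (j + 1)) = fun j => enterFactor m (j + 1) := rfl
  rw [colsGenPart_succ_true, colsGen_eq, e]
  simp only [enterFactor, Bool.not_true, Bool.false_and, Bool.false_eq_true, if_false,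
    Polynomial.C_1]
  ring

/-- Eliminating the two states of the first column leaves a three-term recurrence, with last
coefficient w 1 * m 0. For the exit factors it is w 0 * n 0 instead, and these coincide under the
relation w j * n j = w (j + 1) * m j. -/
lemma colsGen_enter_add_two (N : ℕ) (w m : ℕ → ℝ) :
    colsGen (N + 2) w (enterFactor m) = (1 + Polynomial.C (w 0) * Polynomial.X) *
        colsGen (N + 1) (fun j => w (j + 1)) (enterFactor fun j => m (j + 1)) -
      Polynomial.C (w 1 * m 0) * Polynomial.X *
        colsGen N (fun j => w (j + 2)) (enterFactor fun j => m (j + 2)) := by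
  rw [colsGen_eq, colsGenPart_enter_false, colsGenPart_enter_true, colsGenPart_enter_true,
    Polynomial.C_mul]
  ring

lemma colsGenPart_exit_false (N : ℕ) (w n : ℕ → ℝ) :
    colsGenPart (N + 1) w (exitFactor n) false =
      colsGen N (fun j => w (j + 1)) (exitFactor fun j => n (j + 1)) := by
  have e : exitFactor (fun j => n (j + 1)) = fun j => exitFactor n (j + 1) := rfl
  rw [colsGenPart_succ_false, colsGen_eq, e]
  simp only [exitFactor, Bool.false_and, Bool.false_eq_true, if_false, Polynomial.C_1]
  ring

lemma colsGenPart_exit_true (N : ℕ) (w n : ℕ → ℝ) :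
    colsGenPart (N + 1) w (exitFactor n) true = Polynomial.C (w 0) * Polynomial.X *
      (colsGen N (fun j => w (j + 1)) (exitFactor fun j => n (j + 1)) - Polynomial.C (n 0) *
        colsGenPart N (fun j => w (j + 1)) (exitFactor fun j => n (j + 1)) false) := by
  have e : exitFactor (fun j => n (j + 1)) = fun j => exitFactor n (j + 1) := rfl
  rw [colsGenPart_succ_true, colsGen_eq, e]
  simp only [exitFactor, Bool.not_false, Bool.not_true, Bool.true_and, Bool.false_eq_true, if_false,
    if_true, Polynomial.C_1, Polynomial.C_sub]
  ring

lemma colsGen_exit_add_two (N : ℕ) (w n : ℕ → ℝ) :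
    colsGen (N + 2) w (exitFactor n) = (1 + Polynomial.C (w 0) * Polynomial.X) *
        colsGen (N + 1) (fun j => w (j + 1)) (exitFactor fun j => n (j + 1)) -
      Polynomial.C (w 0 * n 0) * Polynomial.X *
        colsGen N (fun j => w (j + 2)) (exitFactor fun j => n (j + 2)) := by
  rw [colsGen_eq, colsGenPart_exit_false, colsGenPart_exit_true, colsGenPart_exit_false,
    Polynomial.C_mul]
  ring

lemma colsGen_zero (w : ℕ → ℝ) (g : ℕ → Bool → Bool → ℝ) : colsGen 0 w g = 1 := by
  simp [colsGen_eq, colsGenPart_zero]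

lemma colsGen_enter_one (w m : ℕ → ℝ) :
    colsGen 1 w (enterFactor m) = 1 + Polynomial.C (w 0) * Polynomial.X := by
  simp [colsGen_eq, colsGenPart_succ_false, colsGenPart_succ_true, colsGenPart_zero, enterFactor]

lemma colsGen_exit_one (w n : ℕ → ℝ) :
    colsGen 1 w (exitFactor n) = 1 + Polynomial.C (w 0 * (1 - n 0)) * Polynomial.X := by
  simp [colsGen_eq, colsGenPart_succ_false, colsGenPart_succ_true, colsGenPart_zero, exitFactor]
  ring

/-- Only initial segments T have nonzero weight, which gives 1 + X + ⋯ + X^N. -/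
lemma colsGen_enter_of_eq_one (N : ℕ) (w m : ℕ → ℝ) (hw : ∀ j, w j = 1) (hm : ∀ j, m j = 1) :
    (1 - Polynomial.X) * colsGen N w (enterFactor m) = 1 - Polynomial.X ^ (N + 1) := by
  induction N using Nat.twoStepInduction generalizing w m with
  | zero => simp [colsGen_zero]
  | one => rw [colsGen_enter_one, hw, Polynomial.C_1]; ring
  | more N h1 h2 =>
    rw [colsGen_enter_add_two, hw, hw, hm, mul_one, Polynomial.C_1]
    linear_combination (1 + Polynomial.X) *
      h2 (fun j => w (j + 1)) (fun j => m (j + 1)) (fun j => hw _) (fun j => hm _) -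
      Polynomial.X * h1 (fun j => w (j + 2)) (fun j => m (j + 2)) (fun j => hw _) (fun j => hm _)

/-- The largest element of a nonempty T contributes an exit factor zero, so only T = ∅ counts. -/
lemma colsGen_exit_of_eq_one (N : ℕ) (w n : ℕ → ℝ) (hw : ∀ j, w j = 1) (hn : ∀ j, n j = 1) :
    colsGen N w (exitFactor n) = 1 := by
  induction N using Nat.twoStepInduction generalizing w n with
  | zero => simp [colsGen_zero]
  | one => rw [colsGen_exit_one, hn]; simp
  | more N h1 h2 =>
    rw [colsGen_exit_add_two, hw, hn, mul_one, Polynomial.C_1,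
      h2 _ _ (fun j => hw _) (fun j => hn _), h1 _ _ (fun j => hw _) (fun j => hn _)]
    ring

/-- The two generating functions agree up to the factor `1 - X`, to high order in `X`. -/
lemma X_pow_dvd_colsGen (M N : ℕ) (w m n : ℕ → ℝ) (hw : ∀ j, M ≤ j → w j = 1)
    (hm : ∀ j, M ≤ j → m j = 1) (hn : ∀ j, M ≤ j → n j = 1)
    (hrel : ∀ j, w j * n j = w (j + 1) * m j) :
    Polynomial.X ^ (N + 1 - M) ∣
      (1 - Polynomial.X) * colsGen N w (enterFactor m) - colsGen N w (exitFactor n) := by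
  induction M generalizing N w m n with
  | zero =>
    rw [colsGen_enter_of_eq_one N w m (fun j => hw j (Nat.zero_le j)) fun j => hm j (Nat.zero_le j),
      colsGen_exit_of_eq_one N w n (fun j => hw j (Nat.zero_le j)) fun j => hn j (Nat.zero_le j)]
    exact ⟨-1, by simp⟩
  | succ M ih =>
    match N with
    | 0 => simp
    | 1 =>
      rw [colsGen_enter_one, colsGen_exit_one]
      refine (pow_dvd_pow Polynomial.X (by omega : 1 + 1 - (M + 1) ≤ 1)).trans ?_
      rw [pow_one]
      exact ⟨Polynomial.C (w 0 * n 0) - 1 - Polynomial.C (w 0) * Polynomial.X, by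
        simp only [Polynomial.C_mul, Polynomial.C_sub, Polynomial.C_1]; ring⟩
    | N + 2 =>
      rw [colsGen_enter_add_two, colsGen_exit_add_two, hrel 0]
      have h1 := ih (N + 1) (fun j => w (j + 1)) (fun j => m (j + 1)) (fun j => n (j + 1))
        (fun j hj => hw _ (by omega)) (fun j hj => hm _ (by omega)) (fun j hj => hn _ (by omega))
        (fun j => hrel _)
      have h2 := ih N (fun j => w (j + 2)) (fun j => m (j + 2)) (fun j => n (j + 2))
        (fun j hj => hw _ (by omega)) (fun j hj => hm _ (by omega)) (fun j hj => hn _ (by omega))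
        (fun j => hrel _)
      have e1 : N + 2 + 1 - (M + 1) = N + 1 + 1 - M := by omega
      -- The term with N columns is known to one order less, which its extra factor X makes up for.
      have h3 : Polynomial.X ^ (N + 2 + 1 - (M + 1)) ∣ Polynomial.X *
          ((1 - Polynomial.X) * colsGen N (fun j => w (j + 2)) (enterFactor fun j => m (j + 2)) -
            colsGen N (fun j => w (j + 2)) (exitFactor fun j => n (j + 2))) := by
        refine (pow_dvd_pow Polynomial.X (by omega : _ ≤ 1 + (N + 1 - M))).trans ?_
        rw [pow_add, pow_one]
        exact mul_dvd_mul_left _ h2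
      have h4 := dvd_sub (Dvd.dvd.mul_left (e1 ▸ h1) (1 + Polynomial.C (w 0) * Polynomial.X))
        (Dvd.dvd.mul_left h3 (Polynomial.C (w 1 * m 0)))
      convert h4 using 1
      ring

lemma coeff_colsGen (N : ℕ) (w : ℕ → ℝ) (g : ℕ → Bool → Bool → ℝ) (r : ℕ) :
    (colsGen N w g).coeff r =
      ∑ T ∈ (range N).powerset, if r = T.card then colsWeight N w g T else 0 := by
  rw [colsGen, Polynomial.finsetSum_coeff]
  refine sum_congr rfl fun T _ => ?_
  rw [Polynomial.coeff_C_mul_X_pow]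

lemma coeff_colsGen_succ (M N : ℕ) (w m n : ℕ → ℝ) (hw : ∀ j, M ≤ j → w j = 1)
    (hm : ∀ j, M ≤ j → m j = 1) (hn : ∀ j, M ≤ j → n j = 1)
    (hrel : ∀ j, w j * n j = w (j + 1) * m j) (r : ℕ) (hr : r + M < N) :
    (colsGen N w (enterFactor m)).coeff (r + 1) - (colsGen N w (enterFactor m)).coeff r =
      (colsGen N w (exitFactor n)).coeff (r + 1) := by
  have h := Polynomial.X_pow_dvd_iff.1 (X_pow_dvd_colsGen M N w m n hw hm hn hrel) (r + 1)
    (by omega)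
  rw [sub_mul, one_mul, Polynomial.coeff_sub, Polynomial.coeff_sub, Polynomial.coeff_X_mul] at h
  exact sub_eq_zero.1 h

lemma coeff_colsGen_zero (N : ℕ) (w : ℕ → ℝ) (m n : ℕ → ℝ) :
    (colsGen N w (enterFactor m)).coeff 0 = (colsGen N w (exitFactor n)).coeff 0 := by
  rw [coeff_colsGen, coeff_colsGen]
  refine sum_congr rfl fun T _ => ?_
  split_ifs with h
  · rw [eq_comm, card_eq_zero] at h
    simp [h, colsWeight, enterFactor, exitFactor]
  · rfl

/-! ### Sums over partitions of a given size -/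

lemma colLen_zero_le_card (μ : YoungDiagram) : μ.colLen 0 ≤ μ.card := by
  rw [YoungDiagram.colLen_eq_card]
  exact card_le_card (filter_subset _ _)

lemma finite_card_eq (k : ℕ) : {μ : YoungDiagram | μ.card = k}.Finite := by
  refine Set.Finite.of_finite_image (f := YoungDiagram.cells)
    ((range k ×ˢ range k).powerset.finite_toSet.subset ?_) ?_
  · rintro _ ⟨μ, rfl, rfl⟩
    simp only [coe_powerset, Set.mem_preimage, Set.mem_powerset_iff]
    rintro ⟨i, j⟩ h
    have h1 : i < μ.colLen j := YoungDiagram.mem_iff_lt_colLen.1 h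
    have h2 : j < μ.rowLen i := YoungDiagram.mem_iff_lt_rowLen.1 h
    have h3 := μ.rowLen_anti 0 i (Nat.zero_le i)
    have h4 := μ.colLen_anti 0 j (Nat.zero_le j)
    have h5 := rowLen_zero_le_card μ
    have h6 := colLen_zero_le_card μ
    simp only [coe_product, coe_range, Set.mem_prod, Set.mem_Iio]
    omega
  · intro μ _ ν _ h
    exact YoungDiagram.ext h

/-- The partitions of `k`. -/
def ofSize (k : ℕ) : Finset YoungDiagram := (finite_card_eq k).toFinset

lemma mem_ofSize {k : ℕ} {μ : YoungDiagram} : μ ∈ ofSize k ↔ μ.card = k := by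
  simp [ofSize]

/-- Addition of one box to each of the columns in `T`. -/
def addCols (c : ℕ → ℕ) (T : Finset ℕ) : ℕ → ℕ := fun j => c j + if j ∈ T then 1 else 0

lemma addCols_removeStrip {lam : YoungDiagram} {T : Finset ℕ} (h : IsStrip lam T) :
    addCols (removeStrip lam T).colLen T = lam.colLen := by
  funext j
  rw [addCols, colLen_removeStrip h]
  split_ifs with hj
  · have := h.1 j hj; omega
  · simp

/-- Reindexing of the pairs of a partition and a horizontal strip in it by the smaller partition
and the strip. -/
lemma sum_ofSize_strips (k N : ℕ) (hN : k ≤ N) (F : YoungDiagram → Finset ℕ → ℝ)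
    (hF : ∀ μ T, T ⊆ range N → ¬ Antitone (addCols μ.colLen T) → F μ T = 0) :
    ∑ lam ∈ ofSize k, ∑ T ∈ strips lam, F (removeStrip lam T) T =
      ∑ T ∈ (range N).powerset, if T.card ≤ k then ∑ μ ∈ ofSize (k - T.card), F μ T else 0 := by
  rw [← sum_filter, sum_sigma', sum_sigma']
  refine sum_of_injOn (fun p => ⟨p.2, removeStrip p.1 p.2⟩) ?_ ?_ ?_ ?_
  · rintro ⟨lam, T⟩ h ⟨lam', T'⟩ h' heq
    simp only [coe_sigma, Set.mem_sigma_iff, mem_coe, mem_strips] at h h'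
    simp only [Sigma.mk.injEq, heq_eq_eq] at heq
    obtain ⟨rfl, h2⟩ := heq
    congr 1
    refine eq_of_colLen_eq fun j => ?_
    rw [← addCols_removeStrip h.2, h2, addCols_removeStrip h'.2]
  · rintro ⟨lam, T⟩ h
    simp only [coe_sigma, Set.mem_sigma_iff, mem_coe, mem_strips, mem_ofSize, mem_filter,
      mem_powerset] at h ⊢
    have h1 := card_removeStrip h.2
    have h2 := rowLen_zero_le_card lam
    exact ⟨⟨h.2.subset.trans (range_subset_range.2 (by omega)), by omega⟩, by omega⟩
  · rintro ⟨T, μ⟩ h hn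
    simp only [mem_sigma, mem_filter, mem_powerset, mem_ofSize] at h
    -- A pair with nonzero summand is attained: since T can be added to μ, the pair comes from the
    -- diagram with the enlarged columns.
    by_contra hne
    have hanti : Antitone (addCols μ.colLen T) := by
      by_contra hc
      exact hne (hF μ T h.1.1 hc)
    have hN' : ∀ j, N ≤ j → addCols μ.colLen T j = 0 := fun j hj => by
      have h1 := rowLen_zero_le_card μ
      have h2 : j ∉ T := fun hjT => by
        have := mem_range.1 (h.1.1 hjT)
        omega
      rw [addCols, if_neg h2, colLen_eq_zero.2 (by omega)]
    set lam := ofCols (addCols μ.colLen T) N with hlam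
    have hcol : ∀ j, lam.colLen j = addCols μ.colLen T j := colLen_ofCols hanti hN'
    have hrem : removeCols lam.colLen T = μ.colLen := by
      funext j
      rw [removeCols, hcol, addCols, Nat.add_sub_cancel]
    have hstrip : IsStrip lam T := by
      refine ⟨fun j hj => ?_, ?_⟩
      · rw [hcol, addCols, if_pos hj]
        omega
      · rw [hrem]
        exact colLen_antitone μ
    have hremove : removeStrip lam T = μ := eq_of_colLen_eq fun j => by
      rw [colLen_removeStrip hstrip, hcol, addCols, Nat.add_sub_cancel]
    refine hn ⟨⟨lam, T⟩, ?_, ?_⟩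
    · simp only [coe_sigma, Set.mem_sigma_iff, mem_coe, mem_strips, mem_ofSize]
      refine ⟨?_, hstrip⟩
      rw [← card_removeStrip hstrip, hremove]
      omega
    · simp only [hremove]
  · rintro ⟨lam, T⟩ _
    rfl

/-! ### Exponents, normalizations and local weights of a strip -/

lemma sum_mem_eq_sum_range {M : Type*} [AddCommMonoid M] {T : Finset ℕ} {N : ℕ}
    (hT : T ⊆ range N) (f : ℕ → M) :
    ∑ j ∈ T, f j = ∑ j ∈ range N, if j ∈ T then f j else 0 := by
  rw [sum_ite_mem, inter_eq_right.2 hT]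

lemma nStat_eq (μ : YoungDiagram) (N : ℕ) (hN : μ.rowLen 0 ≤ N) :
    nStat μ = ∑ j ∈ range N, (μ.colLen j).choose 2 := by
  refine sum_subset (range_subset_range.2 hN) fun j _ hj => ?_
  rw [colLen_eq_zero.2 (by simpa using hj)]
  rfl

lemma conjPairing_eq_right (μ ν : YoungDiagram) (N : ℕ) (hN : ν.rowLen 0 ≤ N) :
    conjPairing μ ν = ∑ j ∈ range N, μ.colLen j * ν.colLen j := by
  refine sum_subset (range_subset_range.2 hN) fun j _ hj => ?_
  rw [colLen_eq_zero (μ := ν).2 (by simpa using hj), mul_zero]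

lemma conjPairing_comm (μ ν : YoungDiagram) : conjPairing μ ν = conjPairing ν μ := by
  rw [conjPairing_eq_right μ ν (max (μ.rowLen 0) (ν.rowLen 0)) (le_max_right _ _),
    conjPairing_eq_right ν μ (max (μ.rowLen 0) (ν.rowLen 0)) (le_max_left _ _)]
  exact sum_congr rfl fun j _ => mul_comm _ _

lemma conjPairing_removeStrip {lam : YoungDiagram} {T : Finset ℕ} (h : IsStrip lam T)
    (μ : YoungDiagram) :
    conjPairing μ lam = conjPairing μ (removeStrip lam T) + ∑ j ∈ T, μ.colLen j := by
  rw [conjPairing_eq_right μ _ (lam.rowLen 0) le_rfl,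
    conjPairing_eq_right μ _ (lam.rowLen 0) (rowLen_removeStrip_le h),
    sum_mem_eq_sum_range h.subset, ← sum_add_distrib]
  refine sum_congr rfl fun j _ => ?_
  rw [← congrFun (addCols_removeStrip h) j, addCols]
  split_ifs
  · ring
  · ring

lemma nStat_removeStrip {lam : YoungDiagram} {T : Finset ℕ} (h : IsStrip lam T) :
    nStat lam = nStat (removeStrip lam T) + ∑ j ∈ T, (removeStrip lam T).colLen j := by
  rw [nStat, nStat_eq _ (lam.rowLen 0) (rowLen_removeStrip_le h), sum_mem_eq_sum_range h.subset,
    ← sum_add_distrib]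
  refine sum_congr rfl fun j _ => ?_
  rw [← congrFun (addCols_removeStrip h) j, addCols]
  split_ifs
  · rw [Nat.choose_succ_succ' _ 1, Nat.choose_one_right, add_comm]
  · simp

/-- The factor `t^(n(μ) - ∑ μ'_i ν'_i)`. -/
def wt (t : ℝ) (μ ν : YoungDiagram) : ℝ := t ^ ((nStat μ : ℤ) - conjPairing μ ν)

/-- The factor `t^(μ'_j - ν'_j)` of the column `j`. -/
def colRatio (t : ℝ) (μ ν : YoungDiagram) (j : ℕ) : ℝ := t ^ ((μ.colLen j : ℤ) - ν.colLen j)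

/-- The factor `t^(μ'_j - μ'_{j+1})`. -/
def colStep (t : ℝ) (μ : YoungDiagram) (j : ℕ) : ℝ := t ^ (μ.colLen j - μ.colLen (j + 1))

lemma prod_colRatio {t : ℝ} (h0 : t ≠ 0) (μ ν : YoungDiagram) (T : Finset ℕ) :
    ∏ j ∈ T, colRatio t μ ν j = t ^ ((∑ j ∈ T, μ.colLen j : ℕ) - (∑ j ∈ T, ν.colLen j : ℕ) : ℤ) := by
  induction T using Finset.induction_on with
  | empty => simp
  | insert j T hj ih =>
    rw [prod_insert hj, ih, colRatio, ← zpow_add₀ h0, sum_insert hj, sum_insert hj]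
    congr 1
    push_cast
    ring

/-- A new box in column j of μ raises n(μ) by μ'_j and the pairing with ν by ν'_j. -/
lemma wt_removeStrip_left {t : ℝ} (h0 : t ≠ 0) {lam : YoungDiagram} {T : Finset ℕ}
    (h : IsStrip lam T) (ν : YoungDiagram) :
    wt t lam ν = wt t (removeStrip lam T) ν * ∏ j ∈ T, colRatio t (removeStrip lam T) ν j := by
  rw [wt, wt, prod_colRatio h0, ← zpow_add₀ h0, nStat_removeStrip h, conjPairing_comm lam ν,
    conjPairing_removeStrip h, conjPairing_comm ν]
  congr 1
  push_cast
  ring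

lemma bNorm_eq_prod (t : ℝ) (μ : YoungDiagram) (N : ℕ) (hN : μ.rowLen 0 ≤ N) :
    bNorm t μ = ∏ j ∈ range N, qPochhammer t t (μ.colLen j - μ.colLen (j + 1)) := by
  refine prod_subset (range_subset_range.2 hN) fun j _ hj => ?_
  rw [colLen_eq_zero.2 (by simpa using hj)]
  simp [qPochhammer]

/-- In terms of the smaller partition μ, the exponent λ'_j - λ'_{j+1} + 1 at an entry (j not in T, j
+ 1 in T) is μ'_j - μ'_{j+1}. Hence the branching coefficient is a product of local factors
determined by μ and T. -/
lemma prod_enterFactor_eq_psi (t : ℝ) {lam : YoungDiagram} {T : Finset ℕ} (h : IsStrip lam T)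
    (N : ℕ) (hN : lam.rowLen 0 ≤ N) :
    ∏ j ∈ range N, enterFactor (colStep t (removeStrip lam T)) j (decide (j ∈ T))
      (decide (j + 1 ∈ T)) = psi t lam T := by
  rw [← stripWeight_eq_psi t h.subset N hN, stripWeight]
  refine prod_congr rfl fun j _ => ?_
  rw [enterFactor, colStep, colLen_removeStrip h, colLen_removeStrip h]
  by_cases h1 : j ∈ T <;> by_cases h2 : j + 1 ∈ T <;> simp [h1, h2]
  have h3 := h.1 _ h2
  have h4 := colLen_antitone lam (Nat.le_succ j)
  congr 1
  simp only [Nat.succ_eq_add_one] at h4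
  omega

/-- Passing from ν to ν - T, the multiplicity belonging to column j grows by one where T is entered
and drops by one where T is exited. The growth absorbs the factors of `psi`, and the drop leaves the
exit factors. -/
lemma psi_mul_bNorm (t : ℝ) {ν : YoungDiagram} {T : Finset ℕ} (h : IsStrip ν T)
    (N : ℕ) (hN : ν.rowLen 0 ≤ N) :
    psi t ν T * bNorm t ν = bNorm t (removeStrip ν T) * ∏ j ∈ range N,
      exitFactor (colStep t ν) j (decide (j ∈ T)) (decide (j + 1 ∈ T)) := by
  rw [← stripWeight_eq_psi t h.subset N hN, stripWeight, bNorm_eq_prod t ν N hN,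
    bNorm_eq_prod t _ N ((rowLen_removeStrip_le h).trans hN), ← prod_mul_distrib, ← prod_mul_distrib]
  refine prod_congr rfl fun j _ => ?_
  have h4 := colLen_antitone ν (Nat.le_succ j)
  simp only [Nat.succ_eq_add_one] at h4
  have h5 := h.2 (Nat.le_succ j)
  simp only [removeCols, Nat.succ_eq_add_one] at h5
  rw [exitFactor, colStep, colLen_removeStrip h, colLen_removeStrip h]
  by_cases h1 : j ∈ T <;> by_cases h2 : j + 1 ∈ T
  · have h3 := h.1 _ h2
    have e : ν.colLen j - 1 - (ν.colLen (j + 1) - 1) = ν.colLen j - ν.colLen (j + 1) := by omega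
    simp [h1, h2, e]
  · have h3 := h.1 _ h1
    simp only [h1, h2, if_true, if_false, tsub_zero] at h5
    have e : ν.colLen j - ν.colLen (j + 1) = ν.colLen j - 1 - ν.colLen (j + 1) + 1 := by omega
    simp [h1, h2]
    rw [e, qPochhammer_succ]
  · have h3 := h.1 _ h2
    have e : ν.colLen j - (ν.colLen (j + 1) - 1) = ν.colLen j - ν.colLen (j + 1) + 1 := by omega
    simp [h1, h2, e]
    rw [qPochhammer_succ, mul_comm]
  · simp [h1, h2]

/-- Monotonicity can only fail at equal neighbouring columns j, j + 1 of which just the second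
receives a box; there the entry factor is 1 - t^0 = 0. -/
lemma enter_weight_eq_zero (t : ℝ) (μ : YoungDiagram) (N : ℕ) (w : ℕ → ℝ) (T : Finset ℕ)
    (hT : T ⊆ range N) (h : ¬ Antitone (addCols μ.colLen T)) :
    colsWeight N w (enterFactor (colStep t μ)) T = 0 := by
  obtain ⟨j, hj⟩ : ∃ j, addCols μ.colLen T j < addCols μ.colLen T (j + 1) := by
    by_contra! hc
    exact h (antitone_nat_of_succ_le hc)
  have h4 := colLen_antitone μ (Nat.le_succ j)
  simp only [Nat.succ_eq_add_one] at h4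
  have h1 : j ∉ T := fun h1 => by
    simp only [addCols, h1, if_true] at hj
    split_ifs at hj <;> omega
  have h2 : j + 1 ∈ T := by
    by_contra h2
    simp only [addCols, h1, h2, if_false] at hj
    omega
  have h3 : μ.colLen j - μ.colLen (j + 1) = 0 := by
    simp only [addCols, h1, h2, if_false, if_true] at hj
    omega
  have h5 := mem_range.1 (hT h2)
  rw [colsWeight, prod_eq_zero (i := j) (mem_range.2 (by omega)), mul_zero]
  simp [enterFactor, h1, h2, colStep, h3]

lemma exit_weight_eq_zero (t : ℝ) (ν : YoungDiagram) (N : ℕ) (w : ℕ → ℝ) (T : Finset ℕ)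
    (hT : T ⊆ range N) (h : ¬ IsStrip ν T) :
    colsWeight N w (exitFactor (colStep t ν)) T = 0 := by
  suffices ∃ j, j ∈ T ∧ j + 1 ∉ T ∧ ν.colLen j ≤ ν.colLen (j + 1) by
    obtain ⟨j, h1, h2, h3⟩ := this
    rw [colsWeight, prod_eq_zero (i := j) (hT h1), mul_zero]
    simp [exitFactor, h1, h2, colStep, Nat.sub_eq_zero_of_le h3]
  rw [IsStrip, not_and_or] at h
  rcases h with h | h
  · push Not at h
    obtain ⟨j, hj, hj0⟩ := h
    -- If T contains an empty column, its largest column is empty too, and is an exit with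
    -- difference zero.
    have hne : T.Nonempty := ⟨j, hj⟩
    refine ⟨T.max' hne, T.max'_mem hne, fun hm => ?_, ?_⟩
    · have := T.le_max' _ hm
      omega
    · have := colLen_antitone ν (T.le_max' j hj)
      omega
  · obtain ⟨j, hj⟩ : ∃ j, removeCols ν.colLen T j < removeCols ν.colLen T (j + 1) := by
      by_contra! hc
      exact h (antitone_nat_of_succ_le hc)
    have h4 := colLen_antitone ν (Nat.le_succ j)
    simp only [Nat.succ_eq_add_one] at h4
    refine ⟨j, ?_, ?_, ?_⟩
    · by_contra h1
      simp only [removeCols, h1, if_false] at hj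
      omega
    · intro h2
      simp only [removeCols, h2, if_true] at hj
      split_ifs at hj <;> omega
    · simp only [removeCols] at hj
      split_ifs at hj <;> omega

/-- The coefficient `ψ_{ν/κ}(t) P_κ(t, t², …; t) / P_ν(t, t², …; t)` for `κ = ν - T`. -/
def stripRatio (t : ℝ) (ν : YoungDiagram) (T : Finset ℕ) : ℝ :=
  psi t ν T * pVal t (removeStrip ν T) / pVal t ν

/-- Removing T lowers |ν| + n(ν) by the sum of ν'_j over T, and the pairing with μ by the sum of
μ'_j. Together these powers of t give the column ratios, while `psi_mul_bNorm` supplies the exit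
factors. -/
lemma wt_mul_stripRatio {t : ℝ} (ht : |t| < 1) (h0 : t ≠ 0) (μ : YoungDiagram) {ν : YoungDiagram}
    {T : Finset ℕ} (h : IsStrip ν T) (N : ℕ) (hN : ν.rowLen 0 ≤ N) :
    wt t μ (removeStrip ν T) * stripRatio t ν T =
      wt t μ ν * colsWeight N (colRatio t μ ν) (exitFactor (colStep t ν)) T := by
  have hb := psi_mul_bNorm t h N hN
  have hb1 := (bNorm_pos ht ν).ne'
  have hb2 := (bNorm_pos ht (removeStrip ν T)).ne'
  have hcard : ν.card + nStat ν =
      (removeStrip ν T).card + nStat (removeStrip ν T) + ∑ j ∈ T, ν.colLen j := by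
    rw [nStat_removeStrip h, ← card_removeStrip h, card_eq_sum_ones T]
    have : ∑ j ∈ T, ν.colLen j = ∑ j ∈ T, 1 + ∑ j ∈ T, (removeStrip ν T).colLen j := by
      rw [← sum_add_distrib]
      refine sum_congr rfl fun j hj => ?_
      rw [← congrFun (addCols_removeStrip h) j, addCols, if_pos hj, add_comm]
    omega
  have hw : wt t μ (removeStrip ν T) = wt t μ ν * t ^ (∑ j ∈ T, μ.colLen j) := by
    rw [wt, wt, conjPairing_removeStrip h, ← zpow_natCast, ← zpow_add₀ h0]
    congr 1
    push_cast
    ring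
  have hr : ∏ j ∈ T, colRatio t μ ν j * t ^ ν.colLen j = t ^ (∑ j ∈ T, μ.colLen j) := by
    rw [← prod_pow_eq_pow_sum]
    refine prod_congr rfl fun j _ => ?_
    rw [colRatio, zpow_sub₀ h0, zpow_natCast, zpow_natCast, div_mul_cancel₀ _ (pow_ne_zero _ h0)]
  rw [prod_mul_distrib, prod_pow_eq_pow_sum] at hr
  have h1 : (t : ℝ) ^ ((removeStrip ν T).card + nStat (removeStrip ν T)) ≠ 0 := pow_ne_zero _ h0
  have h2 : (t : ℝ) ^ (∑ j ∈ T, ν.colLen j) ≠ 0 := pow_ne_zero _ h0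
  rw [hw, stripRatio, pVal, pVal, hcard, pow_add t _ (∑ j ∈ T, ν.colLen j), colsWeight, ← hr]
  generalize (t : ℝ) ^ ((removeStrip ν T).card + nStat (removeStrip ν T)) = A at *
  field_simp
  linear_combination (wt t μ ν * ∏ j ∈ T, colRatio t μ ν j) * hb

/-! ### The generating function of the moments -/

/-- The sum `∑_{|λ| = k} P_λ(x; t) t^(n(λ) - ∑ λ'_i ν'_i)`. -/
def momentSum (t : ℝ) (ν : YoungDiagram) {n : ℕ} (x : Fin n → ℝ) (k : ℕ) : ℝ :=
  ∑ lam ∈ ofSize k, P t lam x * wt t lam ν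

/-- Both sides equal t^(μ'_j - ν'_{j+1}). This coincidence makes the recurrences for adding strips
to μ and for removing strips from ν agree. -/
lemma colStep_rel {t : ℝ} (h0 : t ≠ 0) (μ ν : YoungDiagram) (j : ℕ) :
    colRatio t μ ν j * colStep t ν j = colRatio t μ ν (j + 1) * colStep t μ j := by
  have h1 := colLen_antitone μ (Nat.le_succ j)
  have h2 := colLen_antitone ν (Nat.le_succ j)
  simp only [Nat.succ_eq_add_one] at h1 h2
  rw [colRatio, colRatio, colStep, colStep, ← zpow_natCast, ← zpow_natCast, ← zpow_add₀ h0,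
    ← zpow_add₀ h0, Nat.cast_sub h1, Nat.cast_sub h2]
  congr 1
  ring

lemma sum_range_ite_card (k N : ℕ) (G : YoungDiagram → Finset ℕ → ℝ) (z : ℝ) :
    (∑ T ∈ (range N).powerset, if T.card ≤ k then
        ∑ μ ∈ ofSize (k - T.card), z ^ T.card * G μ T else 0) =
      ∑ r ∈ range (k + 1), z ^ r * ∑ μ ∈ ofSize (k - r), ∑ T ∈ (range N).powerset,
        if r = T.card then G μ T else 0 := by
  have h : ∀ r, z ^ r * ∑ μ ∈ ofSize (k - r), ∑ T ∈ (range N).powerset,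
      (if r = T.card then G μ T else 0) = ∑ T ∈ (range N).powerset,
        if r = T.card then ∑ μ ∈ ofSize (k - r), z ^ r * G μ T else 0 := by
    intro r
    rw [mul_sum, sum_congr rfl fun μ _ => mul_sum _ _ _, sum_comm]
    refine sum_congr rfl fun T _ => ?_
    split_ifs <;> simp
  rw [sum_congr rfl fun r _ => h r, sum_comm]
  refine sum_congr rfl fun T _ => ?_
  rw [sum_ite_eq' (range (k + 1)) T.card]
  simp only [mem_range, Nat.lt_succ_iff]

/-- The last variable is branched off each P_λ, and the pairs (λ, T) are reindexed by μ = λ - T. For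
fixed μ, the strips of r boxes make up one coefficient of a generating function with entry factors.
-/
lemma momentSum_branching {t : ℝ} (ht : |t| < 1) (h0 : t ≠ 0) (ν : YoungDiagram) {n : ℕ}
    (y : Fin (n + 1) → ℝ) (k N : ℕ) (hN : k ≤ N) :
    momentSum t ν y k = ∑ r ∈ range (k + 1), y (Fin.last n) ^ r * ∑ μ ∈ ofSize (k - r),
      P t μ (fun i : Fin n => y i.castSucc) * wt t μ ν *
        (colsGen N (colRatio t μ ν) (enterFactor (colStep t μ))).coeff r := by
  set x : Fin n → ℝ := fun i => y i.castSucc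
  have h1 := sum_ofSize_strips k N hN (fun μ T => y (Fin.last n) ^ T.card *
    (P t μ x * wt t μ ν * colsWeight N (colRatio t μ ν) (enterFactor (colStep t μ)) T))
    fun μ T hT hc => by rw [enter_weight_eq_zero t μ N _ T hT hc, mul_zero, mul_zero]
  have h2 := sum_range_ite_card k N (fun μ T => P t μ x * wt t μ ν *
    colsWeight N (colRatio t μ ν) (enterFactor (colStep t μ)) T) (y (Fin.last n))
  have h3 := h1.trans h2
  simp only [coeff_colsGen, mul_sum, mul_ite, mul_zero] at h3 ⊢
  rw [← h3]
  refine sum_congr rfl fun lam hlam => ?_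
  rw [P_branching ht, sum_mul]
  refine sum_congr rfl fun T hT => ?_
  have hs := mem_strips.1 hT
  have h2 := rowLen_zero_le_card lam
  rw [mem_ofSize] at hlam
  rw [wt_removeStrip_left h0 hs, colsWeight, prod_enterFactor_eq_psi t hs N (by omega)]
  ring

/-- The counterpart with strips removed from ν: for fixed μ they make up a coefficient with exit
factors. -/
lemma sum_strips_momentSum {t : ℝ} (ht : |t| < 1) (h0 : t ≠ 0) (ν : YoungDiagram) {n : ℕ}
    (x : Fin n → ℝ) (z : ℝ) (k N : ℕ) (hN : ν.rowLen 0 ≤ N) :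
    (∑ T ∈ strips ν, if T.card ≤ k then
      stripRatio t ν T * z ^ T.card * momentSum t (removeStrip ν T) x (k - T.card) else 0) =
    ∑ r ∈ range (k + 1), z ^ r * ∑ μ ∈ ofSize (k - r),
      P t μ x * wt t μ ν *
        (colsGen N (colRatio t μ ν) (exitFactor (colStep t ν))).coeff r := by
  have h := sum_range_ite_card k N (fun μ T => P t μ x * wt t μ ν *
    colsWeight N (colRatio t μ ν) (exitFactor (colStep t ν)) T) z
  simp only [coeff_colsGen, mul_sum, mul_ite, mul_zero] at h ⊢
  classical
  rw [← h, sum_strips ν N hN]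
  refine sum_congr rfl fun T hT => ?_
  by_cases hs : IsStrip ν T
  · rw [if_pos hs]
    split_ifs
    · rw [momentSum, mul_sum]
      refine sum_congr rfl fun μ _ => ?_
      have := wt_mul_stripRatio ht h0 μ hs N hN
      linear_combination (z ^ T.card * P t μ x) * this
    · rfl
  · rw [if_neg hs]
    split_ifs
    · refine (sum_eq_zero fun μ _ => ?_).symm
      rw [exit_weight_eq_zero t ν N _ T (mem_powerset.1 hT) hs, mul_zero, mul_zero]
    · rfl

/-- The generating function of the sums `momentSum` in the size of the partition. -/
def momentSeries (t : ℝ) (ν : YoungDiagram) {n : ℕ} (x : Fin n → ℝ) : PowerSeries ℝ :=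
  PowerSeries.mk (momentSum t ν x)

/-- Separation of one variable in the moment generating function. -/
theorem momentSeries_branching {t : ℝ} (ht : |t| < 1) (h0 : t ≠ 0) (ν : YoungDiagram) {n : ℕ}
    (y : Fin (n + 1) → ℝ) :
    (1 - PowerSeries.C (y (Fin.last n)) * PowerSeries.X) * momentSeries t ν y =
      ∑ T ∈ strips ν, PowerSeries.C (stripRatio t ν T * y (Fin.last n) ^ T.card) *
        (PowerSeries.X ^ T.card * momentSeries t (removeStrip ν T)
          (fun i : Fin n => y i.castSucc)) := by
  ext k
  set z := y (Fin.last n)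
  set x : Fin n → ℝ := fun i => y i.castSucc
  -- N bounds the columns of all diagrams involved, and leaves the room r + M < N needed by
  -- `coeff_colsGen_succ`.
  obtain ⟨N, hN⟩ : ∃ N, N = 2 * k + ν.rowLen 0 + 1 := ⟨_, rfl⟩
  have hR : PowerSeries.coeff k (∑ T ∈ strips ν, PowerSeries.C (stripRatio t ν T * z ^ T.card) *
        (PowerSeries.X ^ T.card * momentSeries t (removeStrip ν T) x)) =
      ∑ T ∈ strips ν, if T.card ≤ k then
        stripRatio t ν T * z ^ T.card * momentSum t (removeStrip ν T) x (k - T.card) else 0 := by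
    rw [map_sum]
    refine sum_congr rfl fun T _ => ?_
    rw [PowerSeries.coeff_C_mul, PowerSeries.coeff_X_pow_mul', momentSeries, PowerSeries.coeff_mk,
      mul_ite, mul_zero]
  rw [hR, sum_strips_momentSum ht h0 ν x z k N (by omega), sub_mul, one_mul, map_sub, mul_assoc,
    PowerSeries.coeff_C_mul]
  cases k with
  | zero =>
    rw [PowerSeries.coeff_zero_X_mul, momentSeries, PowerSeries.coeff_mk,
      momentSum_branching ht h0 ν y 0 N (by omega)]
    simp only [zero_add, range_one, sum_singleton, pow_zero, one_mul, mul_zero, sub_zero]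
    simp only [coeff_colsGen_zero _ _ (colStep t _) (colStep t ν)]
    rfl
  | succ k =>
    rw [PowerSeries.coeff_succ_X_mul, momentSeries, PowerSeries.coeff_mk, PowerSeries.coeff_mk,
      momentSum_branching ht h0 ν y (k + 1) N (by omega),
      momentSum_branching ht h0 ν y k N (by omega), sum_range_succ' _ (k + 1),
      sum_range_succ' _ (k + 1), add_sub_right_comm, mul_sum, ← sum_sub_distrib]
    congr 1
    -- Multiplication by 1 - zX pairs the power r + 1 of z in degree k + 1 with the power r in
    -- degree k. Both run over the partitions μ of k - r, so the difference of consecutive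
    -- coefficients appears.
    · refine sum_congr rfl fun r hr => ?_
      rw [mem_range] at hr
      have e : k + 1 - (r + 1) = k - r := by omega
      rw [e, ← mul_assoc, ← pow_succ', ← mul_sub, ← sum_sub_distrib]
      congr 1
      refine sum_congr rfl fun μ hμ => ?_
      rw [mem_ofSize] at hμ
      rw [← mul_sub]
      congr 1
      have hμr := rowLen_zero_le_card μ
      refine coeff_colsGen_succ (k + ν.rowLen 0) N _ _ _ ?_ ?_ ?_ (colStep_rel h0 μ ν) r (by omega)
      · intro j hj
        rw [colRatio, colLen_eq_zero.2 (by omega), colLen_eq_zero.2 (by omega)]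
        simp
      · intro j hj
        rw [colStep, colLen_eq_zero.2 (by omega)]
        simp
      · intro j hj
        rw [colStep, colLen_eq_zero.2 (by omega)]
        simp
    · simp only [coeff_colsGen_zero _ _ (colStep t _) (colStep t ν)]
      rfl

/-! ### Skew coefficients -/

/-- The partitions of size at most `K`. -/
def upTo (K : ℕ) : Finset YoungDiagram :=
  ((range (K + 1)).finite_toSet.biUnion fun k _ => finite_card_eq k).toFinset

lemma mem_upTo {K : ℕ} {μ : YoungDiagram} : μ ∈ upTo K ↔ μ.card ≤ K := by
  simp [upTo]

open scoped Classical in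
/-- The skew Hall-Littlewood polynomial `P_{ν/μ}(b_0, …, b_{n-1}; t)`. -/
def skewP (t : ℝ) (b : ℕ → ℝ) : ℕ → YoungDiagram → YoungDiagram → ℝ
  | 0, ν, μ => if ν = μ then 1 else 0
  | n + 1, ν, μ => ∑ T ∈ strips ν, psi t ν T * b n ^ T.card * skewP t b n (removeStrip ν T) μ

lemma skewP_succ (t : ℝ) (b : ℕ → ℝ) (n : ℕ) (ν μ : YoungDiagram) :
    skewP t b (n + 1) ν μ =
      ∑ T ∈ strips ν, psi t ν T * b n ^ T.card * skewP t b n (removeStrip ν T) μ := rfl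

lemma P_append_eq_sum {t : ℝ} (ht : |t| < 1) (b : ℕ → ℝ) {m : ℕ} (x : Fin m → ℝ) (n : ℕ)
    (ν : YoungDiagram) (K : ℕ) (hK : ν.card ≤ K) :
    P t ν (Fin.append x fun j : Fin n => b j) = ∑ μ ∈ upTo K, skewP t b n ν μ * P t μ x := by
  induction n generalizing ν with
  | zero =>
    have h : Fin.append x (fun j : Fin 0 => b j) = x := by
      rw [Fin.append_right_nil _ _ rfl]
      rfl
    simp only [skewP, ite_mul, one_mul, zero_mul]
    classical
    rw [sum_ite_eq, if_pos (mem_upTo.2 hK)]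
    exact congrArg (P t ν) h
  | succ n ih =>
    rw [P_append_right ht]
    simp only [skewP_succ, sum_mul]
    rw [sum_comm]
    refine sum_congr rfl fun T hT => ?_
    have h := ih (removeStrip ν T) (by have := card_removeStrip (mem_strips.1 hT); omega)
    simp only [Fin.val_last, Fin.val_castSucc] at h ⊢
    rw [h, mul_sum]
    refine sum_congr rfl fun μ _ => ?_
    ring

/-- By induction on |ν|. The empty strip cancels in the increment from n to n + 1; every other strip
carries a positive power of t^(n+1) times a sequence that is bounded by induction. The increments
are thus O(|t|^n). -/
lemma exists_tendsto_skewP {t : ℝ} (ht : |t| < 1) (ν μ : YoungDiagram) :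
    ∃ L : ℝ, Tendsto (fun n => skewP t (fun i => t ^ (i + 1)) n ν μ) atTop (𝓝 L) := by
  induction hk : ν.card using Nat.strong_induction_on generalizing ν with
  | _ k ih =>
    set b : ℕ → ℝ := fun i => t ^ (i + 1)
    set f : ℕ → ℝ := fun n => skewP t b n ν μ
    have hdiff : ∀ n, f (n + 1) - f n = ∑ T ∈ (strips ν).erase ∅,
        psi t ν T * b n ^ T.card * skewP t b n (removeStrip ν T) μ := fun n => by
      have h := add_sum_erase (strips ν)
        (fun T => psi t ν T * b n ^ T.card * skewP t b n (removeStrip ν T) μ)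
        (mem_strips.2 (isStrip_empty ν))
      simp only [psi_empty, removeStrip_empty, card_empty, pow_zero, one_mul] at h
      rw [show f (n + 1) = _ from skewP_succ t b n ν μ, ← h, add_sub_cancel_left]
    have hO : (fun n => f (n + 1) - f n) =O[atTop] fun n : ℕ => |t| ^ n := by
      simp only [hdiff]
      refine Asymptotics.IsBigO.fun_sum fun T hT => ?_
      rw [mem_erase, mem_strips] at hT
      have hcard : 0 < T.card := card_pos.2 (nonempty_iff_ne_empty.2 hT.1)
      obtain ⟨L, hL⟩ := ih (removeStrip ν T).card
        (by have := card_removeStrip hT.2; omega) (removeStrip ν T) rfl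
      have h1 : (fun n => b n ^ T.card) =O[atTop] fun n : ℕ => |t| ^ n := by
        refine Asymptotics.isBigO_of_le _ fun n => ?_
        rw [Real.norm_eq_abs, Real.norm_eq_abs, abs_pow, abs_pow, ← pow_mul, abs_pow, abs_abs]
        refine pow_le_pow_of_le_one (abs_nonneg t) ht.le ?_
        nlinarith
      have h2 := (h1.const_mul_left (psi t ν T)).mul (hL.isBigO_one ℝ)
      simpa using h2
    have hs : Summable fun n => f (n + 1) - f n :=
      summable_of_isBigO_nat (summable_geometric_of_lt_one (abs_nonneg t) ht) hO
    refine ⟨f 0 + ∑' n, (f (n + 1) - f n), ?_⟩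
    have h := hs.hasSum.tendsto_sum_nat.const_add (f 0)
    refine h.congr fun n => ?_
    rw [sum_range_sub, add_sub_cancel]

/-- The value `P_{ν/μ}(t, t², …; t)`. -/
def skewLim (t : ℝ) (ν μ : YoungDiagram) : ℝ :=
  limUnder atTop fun n => skewP t (fun i => t ^ (i + 1)) n ν μ

lemma tendsto_skewP {t : ℝ} (ht : |t| < 1) (ν μ : YoungDiagram) :
    Tendsto (fun n => skewP t (fun i => t ^ (i + 1)) n ν μ) atTop (𝓝 (skewLim t ν μ)) :=
  tendsto_nhds_limUnder (exists_tendsto_skewP ht ν μ)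

/-- The polynomial `∑_μ P_{ν/μ}(t, t², …) P_μ(x) X^|μ| / P_ν(t, t², …)`. -/
def skewPoly (t : ℝ) (ν : YoungDiagram) {n : ℕ} (x : Fin n → ℝ) : Polynomial ℝ :=
  ∑ μ ∈ upTo ν.card, Polynomial.C (skewLim t ν μ / pVal t ν * P t μ x) * Polynomial.X ^ μ.card

/-- By homogeneity the variable of `skewPoly` scales x. The polynomial is therefore determined by
these limits, which is how identities for it are obtained below. -/
lemma tendsto_P_append {t : ℝ} (ht : |t| < 1) (h0 : t ≠ 0) (ν : YoungDiagram) {m : ℕ}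
    (x : Fin m → ℝ) (u : ℝ) :
    Tendsto (fun n : ℕ => P t ν (Fin.append (fun i => u * x i) fun j : Fin n => t ^ ((j : ℕ) + 1)))
      atTop (𝓝 (pVal t ν * (skewPoly t ν x).eval u)) := by
  have h : pVal t ν * (skewPoly t ν x).eval u =
      ∑ μ ∈ upTo ν.card, skewLim t ν μ * P t μ fun i => u * x i := by
    rw [skewPoly, Polynomial.eval_finsetSum, mul_sum]
    refine sum_congr rfl fun μ _ => ?_
    have := pVal_ne_zero ht h0 ν
    rw [Polynomial.eval_mul, Polynomial.eval_C, Polynomial.eval_pow, Polynomial.eval_X,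
      P_mul_left ht]
    field_simp
  rw [h]
  simp only [fun n => P_append_eq_sum ht (fun i => t ^ (i + 1)) (fun i => u * x i) n ν _ le_rfl]
  exact tendsto_finsetSum _ fun μ _ => (tendsto_skewP ht ν μ).mul_const _

lemma skewPoly_branching {t : ℝ} (ht : |t| < 1) (h0 : t ≠ 0) (ν : YoungDiagram) {n : ℕ}
    (y : Fin (n + 1) → ℝ) :
    skewPoly t ν y = ∑ T ∈ strips ν, Polynomial.C (stripRatio t ν T * y (Fin.last n) ^ T.card) *
      (Polynomial.X ^ T.card * skewPoly t (removeStrip ν T) fun i : Fin n => y i.castSucc) := by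
  refine Polynomial.funext fun u => mul_left_cancel₀ (pVal_ne_zero ht h0 ν) ?_
  refine tendsto_nhds_unique (tendsto_P_append ht h0 ν y u) ?_
  simp only [P_append_left ht]
  rw [Polynomial.eval_finsetSum, mul_sum]
  refine tendsto_finsetSum _ fun T _ => ?_
  have h := (tendsto_P_append ht h0 (removeStrip ν T) (fun i : Fin n => y i.castSucc) u).const_mul
    (psi t ν T * (u * y (Fin.last n)) ^ T.card)
  convert h using 2
  have := pVal_ne_zero ht h0 ν
  rw [Polynomial.eval_mul, Polynomial.eval_C, Polynomial.eval_mul, Polynomial.eval_pow,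
    Polynomial.eval_X, stripRatio]
  field_simp
  ring

lemma skewPoly_zero {t : ℝ} (ht : |t| < 1) (h0 : t ≠ 0) (ν : YoungDiagram) (x : Fin 0 → ℝ) :
    skewPoly t ν x = 1 := by
  refine Polynomial.funext fun u => mul_left_cancel₀ (pVal_ne_zero ht h0 ν) ?_
  refine tendsto_nhds_unique (tendsto_P_append ht h0 ν x u) ?_
  rw [Polynomial.eval_one, mul_one]
  refine (tendsto_P_geom_succ ht h0 ν).congr fun n => ?_
  rw [Fin.append_left_nil _ _ rfl]
  exact (P_comp_equiv ht ν (finCongr (Nat.zero_add n)) _).symm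

lemma pVal_bot (t : ℝ) : pVal t ⊥ = 1 := by
  have h := rowLen_zero_le_card ⊥
  rw [card_bot, Nat.le_zero] at h
  simp [pVal, card_bot, nStat, bNorm, h]

lemma skewPoly_bot {t : ℝ} (ht : |t| < 1) (h0 : t ≠ 0) {n : ℕ} (x : Fin n → ℝ) :
    skewPoly t ⊥ x = 1 := by
  refine Polynomial.funext fun u => ?_
  have h := tendsto_P_append ht h0 ⊥ x u
  simp only [P_bot ht, pVal_bot, one_mul] at h
  rw [Polynomial.eval_one]
  exact tendsto_nhds_unique h tendsto_const_nhds

/-! ### The product formula for the moment series -/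

lemma wt_bot_left (t : ℝ) (ν : YoungDiagram) : wt t ⊥ ν = 1 := by
  simp [wt, conjPairing, nStat, colLen_bot]

lemma momentSeries_zero {t : ℝ} (ht : |t| < 1) (ν : YoungDiagram) (x : Fin 0 → ℝ) :
    momentSeries t ν x = 1 := by
  ext k
  rw [momentSeries, PowerSeries.coeff_mk, momentSum, PowerSeries.coeff_one]
  simp only [P_zero ht, ite_mul, one_mul, zero_mul]
  classical
  rw [sum_ite_eq', wt_bot_left]
  simp only [mem_ofSize, card_bot, eq_comm]

/-- Up to the factor 1 - zX for the separated variable z, `momentSeries` and `skewPoly` satisfy the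
same recursion over the strips of ν, and both equal 1 without variables. -/
theorem prod_mul_momentSeries {t : ℝ} (ht : |t| < 1) (h0 : t ≠ 0) (ν : YoungDiagram) {n : ℕ}
    (x : Fin n → ℝ) :
    (∏ i, (1 - PowerSeries.C (x i) * PowerSeries.X)) * momentSeries t ν x =
      (skewPoly t ν x : PowerSeries ℝ) := by
  induction n generalizing ν with
  | zero => simp [momentSeries_zero ht, skewPoly_zero ht h0]
  | succ n ih =>
    rw [Fin.prod_univ_castSucc, mul_assoc, momentSeries_branching ht h0, skewPoly_branching ht h0,
      mul_sum, ← Polynomial.coeToPowerSeries.ringHom_apply, map_sum]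
    refine sum_congr rfl fun T _ => ?_
    rw [Polynomial.coeToPowerSeries.ringHom_apply, Polynomial.coe_mul, Polynomial.coe_mul, ← ih,
      Polynomial.coe_C, Polynomial.coe_pow, Polynomial.coe_X]
    ring

/-- The case of the empty partition replaces the product over the variables, which need not have a
limit that is known in advance, by a series of the P_μ. -/
theorem momentSeries_eq_mul {t : ℝ} (ht : |t| < 1) (h0 : t ≠ 0) (ν : YoungDiagram) {n : ℕ}
    (x : Fin n → ℝ) :
    momentSeries t ν x = momentSeries t ⊥ x * (skewPoly t ν x : PowerSeries ℝ) := by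
  have h1 := prod_mul_momentSeries ht h0 ⊥ x
  rw [skewPoly_bot ht h0, Polynomial.coe_one] at h1
  rw [← prod_mul_momentSeries ht h0 ν x, mul_left_comm, ← mul_assoc, h1, one_mul]

/-! ### Passage to infinitely many variables -/

lemma tendsto_P_PInf {t : ℝ} {μ : YoungDiagram} {a : ℕ → ℝ} (h : PConverges t μ a) :
    Tendsto (fun n : ℕ => P t μ fun i : Fin n => a i) atTop (𝓝 (PInf t μ a)) :=
  tendsto_nhds_limUnder h

lemma QInf_geom {t : ℝ} (ht : |t| < 1) (h0 : t ≠ 0) (μ : YoungDiagram) :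
    (QInf t μ fun i => t ^ i) = t ^ nStat μ :=
  (tendsto_Q_geom ht h0 μ).limUnder_eq

/-- The limit of `momentSum` in infinitely many variables. -/
def momentSumInf (t : ℝ) (ν : YoungDiagram) (a : ℕ → ℝ) (k : ℕ) : ℝ :=
  ∑ lam ∈ ofSize k, PInf t lam a * wt t lam ν

/-- The limit of `skewPoly` in infinitely many variables. -/
def skewPolyInf (t : ℝ) (ν : YoungDiagram) (a : ℕ → ℝ) : Polynomial ℝ :=
  ∑ μ ∈ upTo ν.card, Polynomial.C (skewLim t ν μ / pVal t ν * PInf t μ a) * Polynomial.X ^ μ.card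

lemma tendsto_momentSum {t : ℝ} (ν : YoungDiagram) {a : ℕ → ℝ}
    (ha : ∀ μ : YoungDiagram, PConverges t μ a) (k : ℕ) :
    Tendsto (fun n : ℕ => momentSum t ν (fun i : Fin n => a i) k) atTop
      (𝓝 (momentSumInf t ν a k)) :=
  tendsto_finsetSum _ fun lam _ => (tendsto_P_PInf (ha lam)).mul_const _

lemma tendsto_coeff_skewPoly {t : ℝ} (ν : YoungDiagram) {a : ℕ → ℝ}
    (ha : ∀ μ : YoungDiagram, PConverges t μ a) (k : ℕ) :
    Tendsto (fun n : ℕ => (skewPoly t ν (fun i : Fin n => a i)).coeff k) atTop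
      (𝓝 ((skewPolyInf t ν a).coeff k)) := by
  simp only [skewPoly, skewPolyInf, Polynomial.finsetSum_coeff, Polynomial.coeff_C_mul_X_pow]
  refine tendsto_finsetSum _ fun μ _ => ?_
  split_ifs
  · exact (tendsto_P_PInf (ha μ)).const_mul _
  · exact tendsto_const_nhds

lemma momentSumInf_eq {t : ℝ} (ht : |t| < 1) (h0 : t ≠ 0) (ν : YoungDiagram) {a : ℕ → ℝ}
    (ha : ∀ μ : YoungDiagram, PConverges t μ a) (k : ℕ) :
    momentSumInf t ν a k = ∑ p ∈ antidiagonal k,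
      momentSumInf t ⊥ a p.1 * (skewPolyInf t ν a).coeff p.2 := by
  refine tendsto_nhds_unique (tendsto_momentSum ν ha k) ?_
  have h : ∀ n : ℕ, momentSum t ν (fun i : Fin n => a i) k = ∑ p ∈ antidiagonal k,
      momentSum t ⊥ (fun i : Fin n => a i) p.1 * (skewPoly t ν fun i : Fin n => a i).coeff p.2 :=
    fun n => by
      have := congrArg (PowerSeries.coeff k) (momentSeries_eq_mul ht h0 ν fun i : Fin n => a i)
      rw [PowerSeries.coeff_mul] at this
      simpa only [momentSeries, PowerSeries.coeff_mk, Polynomial.coeff_coe] using this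
  simp only [h]
  exact tendsto_finsetSum _ fun p _ => (tendsto_momentSum ⊥ ha p.1).mul
    (tendsto_coeff_skewPoly ν ha p.2)

/-- The value is a finite sum of products of a function of n and a function of m, so the joint limit
exists without further estimates. -/
lemma tendsto_P_append_PInf {t : ℝ} (ht : |t| < 1) (h0 : t ≠ 0) (ν : YoungDiagram) {a : ℕ → ℝ}
    (ha : ∀ μ : YoungDiagram, PConverges t μ a) :
    Tendsto (fun mn : ℕ × ℕ =>
      P t ν (Fin.append (fun i : Fin mn.1 => a i) (fun j : Fin mn.2 => t ^ ((j : ℕ) + 1))))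
      (atTop ×ˢ atTop) (𝓝 (pVal t ν * (skewPolyInf t ν a).eval 1)) := by
  have h : pVal t ν * (skewPolyInf t ν a).eval 1 =
      ∑ μ ∈ upTo ν.card, skewLim t ν μ * PInf t μ a := by
    rw [skewPolyInf, Polynomial.eval_finsetSum, mul_sum]
    refine sum_congr rfl fun μ _ => ?_
    have := pVal_ne_zero ht h0 ν
    rw [Polynomial.eval_mul, Polynomial.eval_C, Polynomial.eval_pow, Polynomial.eval_X, one_pow]
    field_simp
  rw [h]
  simp only [fun mn : ℕ × ℕ => P_append_eq_sum ht (fun i => t ^ (i + 1))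
    (fun i : Fin mn.1 => a i) mn.2 ν _ le_rfl]
  exact tendsto_finsetSum _ fun μ _ => ((tendsto_skewP ht ν μ).comp tendsto_snd).mul
    ((tendsto_P_PInf (ha μ)).comp tendsto_fst)

/-- The summand `P_λ(a; t) Q_λ(1, t, …; t) t^(-∑ λ'_i ν'_i)` of the moment. -/
def momentTerm (t : ℝ) (a : ℕ → ℝ) (ν lam : YoungDiagram) : ℝ :=
  weight t a lam * t ^ (-(conjPairing lam ν : ℤ))

lemma momentTerm_eq {t : ℝ} (ht : |t| < 1) (h0 : t ≠ 0) (a : ℕ → ℝ) (ν lam : YoungDiagram) :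
    momentTerm t a ν lam = PInf t lam a * wt t lam ν := by
  rw [momentTerm, weight, QInf_geom ht h0, wt, sub_eq_add_neg, zpow_add₀ h0, zpow_natCast, mul_assoc]

lemma momentTerm_bot (t : ℝ) (a : ℕ → ℝ) (lam : YoungDiagram) :
    momentTerm t a ⊥ lam = weight t a lam := by
  have h : conjPairing lam ⊥ = 0 := by
    rw [conjPairing_comm, conjPairing]
    simp [colLen_bot]
  simp [momentTerm, h]

lemma sum_upTo_momentTerm {t : ℝ} (ht : |t| < 1) (h0 : t ≠ 0) (a : ℕ → ℝ) (ν : YoungDiagram)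
    (K : ℕ) :
    ∑ lam ∈ upTo K, momentTerm t a ν lam = ∑ k ∈ range (K + 1), momentSumInf t ν a k := by
  rw [← sum_fiberwise_of_maps_to (s := upTo K) (t := range (K + 1)) (g := YoungDiagram.card)
    fun μ hμ => mem_range.2 (Nat.lt_succ_iff.2 (mem_upTo.1 hμ))]
  refine sum_congr rfl fun k hk => ?_
  rw [momentSumInf]
  refine sum_congr ?_ fun lam _ => momentTerm_eq ht h0 a ν lam
  ext μ
  rw [mem_filter, mem_upTo, mem_ofSize, and_iff_right_iff_imp]
  rintro rfl
  exact Nat.lt_succ_iff.1 (mem_range.1 hk)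

/-! ### Summation over all partitions -/

lemma tendsto_upTo : Tendsto upTo atTop atTop :=
  tendsto_atTop_finset_of_monotone
    (fun _ _ h _ hμ => mem_upTo.2 ((mem_upTo.1 hμ).trans h)) fun μ => ⟨μ.card, mem_upTo.2 le_rfl⟩

lemma tendsto_sum_momentSumInf {t : ℝ} (ht : |t| < 1) (h0 : t ≠ 0) {a : ℕ → ℝ} {ν : YoungDiagram}
    (hs : Summable (momentTerm t a ν)) :
    Tendsto (fun K => ∑ k ∈ range (K + 1), momentSumInf t ν a k) atTop
      (𝓝 (∑' lam, momentTerm t a ν lam)) :=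
  (hs.hasSum.comp tendsto_upTo).congr fun K => sum_upTo_momentTerm ht h0 a ν K

lemma hasSum_momentSumInf_bot {t : ℝ} (ht : |t| < 1) (h0 : t ≠ 0) {a : ℕ → ℝ}
    (hsum : Summable (weight t a)) (hnonneg : ∀ μ : YoungDiagram, 0 ≤ weight t a μ) :
    HasSum (momentSumInf t ⊥ a) (∑' lam, weight t a lam) ∧ ∀ k, 0 ≤ momentSumInf t ⊥ a k := by
  have hw : momentTerm t a ⊥ = weight t a := funext fun lam => momentTerm_bot t a lam
  have hpos : ∀ k, 0 ≤ momentSumInf t ⊥ a k := fun k => sum_nonneg fun lam _ => by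
    rw [← momentTerm_eq ht h0, momentTerm_bot]
    exact hnonneg lam
  refine ⟨(hasSum_iff_tendsto_nat_of_nonneg hpos _).2 ?_, hpos⟩
  rw [← hw] at hsum ⊢
  exact (tendsto_add_atTop_iff_nat 1).1 (tendsto_sum_momentSumInf ht h0 hsum)

/-- A Cauchy product of the summable weights, grouped by size, and the finitely many coefficients of
a polynomial. This sums the moments only in groups of equal size; summability over individual
partitions is established separately. -/
lemma hasSum_momentSumInf {t : ℝ} (ht : |t| < 1) (h0 : t ≠ 0) {a : ℕ → ℝ}
    (ha : ∀ μ : YoungDiagram, PConverges t μ a) (hsum : Summable (weight t a))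
    (hnonneg : ∀ μ : YoungDiagram, 0 ≤ weight t a μ) (ν : YoungDiagram) :
    HasSum (momentSumInf t ν a) ((∑' lam, weight t a lam) * (skewPolyInf t ν a).eval 1) := by
  obtain ⟨h1, hpos⟩ := hasSum_momentSumInf_bot ht h0 hsum hnonneg
  set p := skewPolyInf t ν a
  have hp : HasSum p.coeff (p.eval 1) := by
    rw [Polynomial.eval_eq_sum_range]
    simp only [one_pow, mul_one]
    refine hasSum_sum_of_ne_finset_zero fun k hk => Polynomial.coeff_eq_zero_of_natDegree_lt ?_
    simpa using hk
  have hn1 : Summable fun k => ‖momentSumInf t ⊥ a k‖ := h1.summable.norm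
  have hn2 : Summable fun k => ‖p.coeff k‖ := hp.summable.norm
  have h2 := (summable_norm_sum_mul_antidiagonal_of_summable_norm hn1 hn2).of_norm
  have h3 := tsum_mul_tsum_eq_tsum_sum_antidiagonal_of_summable_norm hn1 hn2
  rw [h1.tsum_eq, hp.tsum_eq] at h3
  rw [h3]
  have e : momentSumInf t ν a = fun k => ∑ q ∈ antidiagonal k, momentSumInf t ⊥ a q.1 * p.coeff q.2 :=
    funext (momentSumInf_eq ht h0 ν ha)
  rw [e]
  exact h2.hasSum

/-- For nonnegative summands, every finite partial sum is bounded by the sum of the series grouped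
by size. -/
lemma summable_momentTerm_of_nonneg {t : ℝ} (ht : |t| < 1) (h0 : t ≠ 0) {a : ℕ → ℝ}
    (ha : ∀ μ : YoungDiagram, PConverges t μ a) (hsum : Summable (weight t a))
    (hnonneg : ∀ μ : YoungDiagram, 0 ≤ weight t a μ) (ν : YoungDiagram)
    (hν : ∀ lam, 0 ≤ momentTerm t a ν lam) : Summable (momentTerm t a ν) := by
  have h := hasSum_momentSumInf ht h0 ha hsum hnonneg ν
  refine summable_of_sum_le hν (c := ∑' k, momentSumInf t ν a k) fun s => ?_
  have hs : s ⊆ upTo (s.sup YoungDiagram.card) := fun μ hμ => mem_upTo.2 (le_sup hμ)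
  refine (sum_le_sum_of_subset_of_nonneg hs fun μ _ _ => hν μ).trans ?_
  rw [sum_upTo_momentTerm ht h0]
  refine h.summable.sum_le_tsum _ fun k _ => sum_nonneg fun lam _ => ?_
  rw [← momentTerm_eq ht h0]
  exact hν lam

/-- The partition in which every column of `ν` is doubled in length. -/
lemma exists_double (ν : YoungDiagram) :
    ∃ ν₂ : YoungDiagram, ∀ lam, conjPairing lam ν₂ = 2 * conjPairing lam ν := by
  have hcol := colLen_ofCols (f := fun j => 2 * ν.colLen j) (N := ν.rowLen 0)
    (fun i j h => Nat.mul_le_mul_left 2 (colLen_antitone ν h))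
    (fun j hj => by rw [colLen_eq_zero.2 hj])
  refine ⟨ofCols (fun j => 2 * ν.colLen j) (ν.rowLen 0), fun lam => ?_⟩
  have hrow : (ofCols (fun j => 2 * ν.colLen j) (ν.rowLen 0)).rowLen 0 ≤ ν.rowLen 0 := by
    rw [← colLen_eq_zero, hcol, colLen_eq_zero.2 le_rfl]
  rw [conjPairing_eq_right _ _ _ hrow, conjPairing, mul_sum]
  refine sum_congr rfl fun j _ => ?_
  rw [hcol]
  ring

/-- For negative t the summands may have either sign. Doubling the columns of ν squares the power of
t, which is then nonnegative, and dominates the original one since |t|^(-1) ≥ 1. -/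
lemma summable_momentTerm {t : ℝ} (ht : |t| < 1) (h0 : t ≠ 0) {a : ℕ → ℝ}
    (ha : ∀ μ : YoungDiagram, PConverges t μ a) (hsum : Summable (weight t a))
    (hnonneg : ∀ μ : YoungDiagram, 0 ≤ weight t a μ) (ν : YoungDiagram) :
    Summable (momentTerm t a ν) := by
  obtain ⟨ν₂, hν₂⟩ := exists_double ν
  have hsq : ∀ lam, momentTerm t a ν₂ lam =
      weight t a lam * (t ^ (-(conjPairing lam ν : ℤ))) ^ 2 := fun lam => by
    rw [momentTerm, hν₂, ← zpow_natCast, ← zpow_mul]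
    congr 2
    push_cast
    ring
  have h2 := summable_momentTerm_of_nonneg ht h0 ha hsum hnonneg ν₂ fun lam => by
    rw [hsq]
    exact mul_nonneg (hnonneg lam) (sq_nonneg _)
  refine Summable.of_norm_bounded h2 fun lam => ?_
  rw [hsq, momentTerm, norm_mul, Real.norm_of_nonneg (hnonneg lam), ← sq_abs, Real.norm_eq_abs]
  refine mul_le_mul_of_nonneg_left ?_ (hnonneg lam)
  have h3 : 1 ≤ |t ^ (-(conjPairing lam ν : ℤ))| := by
    rw [zpow_neg, zpow_natCast, abs_inv, abs_pow]
    exact (one_le_inv₀ (pow_pos (abs_pos.2 h0) _)).2 (pow_le_one₀ (abs_nonneg t) ht.le)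
  nlinarith

theorem tsum_momentTerm {t : ℝ} (ht : |t| < 1) (h0 : t ≠ 0) {a : ℕ → ℝ}
    (ha : ∀ μ : YoungDiagram, PConverges t μ a) (hsum : Summable (weight t a))
    (hnonneg : ∀ μ : YoungDiagram, 0 ≤ weight t a μ) (ν : YoungDiagram) :
    ∑' lam, momentTerm t a ν lam =
      (∑' lam, weight t a lam) * (skewPolyInf t ν a).eval 1 :=
  tendsto_nhds_unique
    ((tendsto_add_atTop_iff_nat 1).1 (tendsto_sum_momentSumInf ht h0
      (summable_momentTerm ht h0 ha hsum hnonneg ν)))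
    (hasSum_momentSumInf ht h0 ha hsum hnonneg ν).tendsto_sum_nat

lemma weight_bot {t : ℝ} (ht : |t| < 1) (h0 : t ≠ 0) (a : ℕ → ℝ) : weight t a ⊥ = 1 := by
  have h1 : PInf t ⊥ a = 1 := by
    rw [PInf]
    simp only [P_bot ht]
    exact tendsto_const_nhds.limUnder_eq
  rw [← momentTerm_bot, momentTerm_eq ht h0, h1, wt_bot_left, one_mul]

lemma tsum_weight_pos {t : ℝ} (ht : |t| < 1) (h0 : t ≠ 0) {a : ℕ → ℝ}
    (hsum : Summable (weight t a)) (hnonneg : ∀ μ : YoungDiagram, 0 ≤ weight t a μ) :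
    0 < ∑' lam, weight t a lam :=
  hsum.tsum_pos hnonneg ⊥ (by rw [weight_bot ht h0]; exact one_pos)

end HallLittlewood

/-! ### Expectations of functions of a discrete random variable -/

/-- The expectation of a function of a random variable with values in a countable set. -/
lemma integrable_and_integral_comp_of_countable {Ω α : Type*} [MeasurableSpace Ω] [Countable α]
    (ℙ : Measure Ω) [IsFiniteMeasure ℙ] (X : Ω → α) (hX : ∀ x, MeasurableSet (X ⁻¹' {x}))
    (f : α → ℝ) (hf : Summable fun x => ℙ.real (X ⁻¹' {x}) * f x) :
    Integrable (fun ω => f (X ω)) ℙ ∧ ∫ ω, f (X ω) ∂ℙ = ∑' x, ℙ.real (X ⁻¹' {x}) * f x := by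
  -- On a countable set, measurability of the fibres is measurability for the full σ-algebra.
  let _ : MeasurableSpace α := ⊤
  have hXm : Measurable X := measurable_to_countable' hX
  have hfm : Measurable f := measurable_from_top
  have hreal : ∀ x, (ℙ.map X).real {x} = ℙ.real (X ⁻¹' {x}) := fun x =>
    map_measureReal_apply hXm (measurableSet_singleton x)
  have hint : Integrable f (ℙ.map X) := by
    rw [← Measure.sum_smul_dirac (ℙ.map X)]
    refine integrable_sum_dirac (fun x => measure_ne_top _ _) ?_
    refine hf.norm.congr fun x => ?_
    rw [norm_mul, Real.norm_of_nonneg measureReal_nonneg, ← hreal]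
    rfl
  refine ⟨hint.comp_measurable hXm, ?_⟩
  rw [← integral_map hXm.aemeasurable hfm.aestronglyMeasurable, integral_countable hint]
  simp only [hreal, smul_eq_mul]

namespace HallLittlewood

instance : Countable YoungDiagram :=
  Function.Injective.countable (f := YoungDiagram.cells) fun _ _ h => YoungDiagram.ext h

end HallLittlewood

end

theorem proposition1p3 (t : ℝ) (ht : t ∈ Set.Ioo (-1 : ℝ) 1 \ {0}) (a : ℕ → ℝ)
    -- the values `P_μ(a_1, a_2, …; t)` are defined
    (ha : ∀ μ : YoungDiagram, HallLittlewood.PConverges t μ a)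
    -- the sum of the weights converges, and the summands are nonnegative
    (hsum : Summable (HallLittlewood.weight t a))
    (hnonneg : ∀ μ : YoungDiagram, 0 ≤ HallLittlewood.weight t a μ)
    -- `lam` is a random partition whose law is proportional to the weights
    {Ω : Type*} [MeasurableSpace Ω] (ℙ : Measure Ω) [IsProbabilityMeasure ℙ]
    (lam : Ω → YoungDiagram) (hlam : ∀ μ : YoungDiagram, MeasurableSet (lam ⁻¹' {μ}))
    (hlaw : ∃ c : ℝ, ∀ μ : YoungDiagram,
      ℙ.real (lam ⁻¹' {μ}) = c * HallLittlewood.weight t a μ)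
    (ν : YoungDiagram) :
    -- the quantities in the claim are well defined
    (∀ μ : YoungDiagram, HallLittlewood.QConverges t μ fun i => t ^ i) ∧
    (0 < ∑' μ : YoungDiagram, HallLittlewood.weight t a μ) ∧
    HallLittlewood.PAppendConverges t ν a (fun i => t ^ (i + 1)) ∧
    HallLittlewood.PConverges t ν (fun i => t ^ (i + 1)) ∧
    HallLittlewood.PInf t ν (fun i => t ^ (i + 1)) ≠ 0 ∧
    Integrable (fun ω => t ^ (-(HallLittlewood.conjPairing (lam ω) ν : ℤ))) ℙ ∧
    -- the moment formula
    ∫ ω, t ^ (-(HallLittlewood.conjPairing (lam ω) ν : ℤ)) ∂ℙ =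
      HallLittlewood.PAppendInf t ν a (fun i => t ^ (i + 1)) /
        HallLittlewood.PInf t ν (fun i => t ^ (i + 1)) := by
  obtain ⟨⟨ht1, ht2⟩, ht0⟩ := ht
  have h0 : t ≠ 0 := ht0
  have h1 : |t| < 1 := abs_lt.2 ⟨ht1, ht2⟩
  obtain ⟨c, hc⟩ := hlaw
  have hP := HallLittlewood.tendsto_P_geom_succ h1 h0 ν
  have hA := HallLittlewood.tendsto_P_append_PInf h1 h0 ν ha
  have hp0 := HallLittlewood.pVal_ne_zero h1 h0 ν
  have hPInf : HallLittlewood.PInf t ν (fun i => t ^ (i + 1)) = HallLittlewood.pVal t ν :=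
    hP.limUnder_eq
  have hAInf : HallLittlewood.PAppendInf t ν a (fun i => t ^ (i + 1)) =
      HallLittlewood.pVal t ν * (HallLittlewood.skewPolyInf t ν a).eval 1 := hA.limUnder_eq
  -- The constant of proportionality is found from the expectation of the constant 1.
  have hcw : c * ∑' μ, HallLittlewood.weight t a μ = 1 := by
    have h := integrable_and_integral_comp_of_countable ℙ lam hlam (fun _ => 1)
      (by simp only [hc, mul_one]; exact hsum.mul_left c)
    have h2 := h.2
    simp only [integral_const, probReal_univ, smul_eq_mul, mul_one, hc, tsum_mul_left] at h2
    exact h2.symm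
  have hmom : ∀ μ, ℙ.real (lam ⁻¹' {μ}) * t ^ (-(HallLittlewood.conjPairing μ ν : ℤ)) =
      c * HallLittlewood.momentTerm t a ν μ := fun μ => by
    rw [hc, HallLittlewood.momentTerm, mul_assoc]
  have hmain := integrable_and_integral_comp_of_countable ℙ lam hlam
    (fun μ => t ^ (-(HallLittlewood.conjPairing μ ν : ℤ)))
    (by
      simp only [hmom]
      exact (HallLittlewood.summable_momentTerm h1 h0 ha hsum hnonneg ν).mul_left c)
  refine ⟨fun μ => ⟨_, HallLittlewood.tendsto_Q_geom h1 h0 μ⟩,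
    HallLittlewood.tsum_weight_pos h1 h0 hsum hnonneg, ⟨_, hA⟩, ⟨_, hP⟩, hPInf ▸ hp0,
    hmain.1, ?_⟩
  rw [hmain.2, hPInf, hAInf, mul_div_cancel_left₀ _ hp0]
  simp only [hmom]
  rw [tsum_mul_left, HallLittlewood.tsum_momentTerm h1 h0 ha hsum hnonneg ν, ← mul_assoc, hcw,
    one_mul]
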